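/- Let $\mathscr{C}$ be a symmetric monoidal category which is, as a category, semisimple abelian (abelian, and every object is a coproduct of simple objects), and whose tensor product $\otimes$ is bi-additive; let $\mathbf 1$ be its unit object. All algebras and Hopf algebras in $\mathscr{C}$ are commutative. For a Hopf algebra $Q$ in $\mathscr{C}$, a $Q$-comodule algebra is an algebra $A$ with a right $Q$-comodule structure $A\to A\otimes Q$ that is an algebra morphism. It is called $Q$-smooth if, for every $Q$-comodule algebra $R$ and every nilpotent $Q$-costable ideal $I$ of $R$, every $Q$-colinear algebra morphism $A\to R/I$ lifts to a $Q$-colinear algebra morphism $A\to R$. An algebra $A$ is called smooth if, for every algebra $R$ and every nilpotent ideal $I$ of $R$, every algebra morphism $A\to R/I$ lifts to an algebra morphism $A\to R$. For a right $Q$-comodule $(V,\rho_V)$ and a left $Q$-comodule $(W,\lambda_W)$, let $V\,\square_Q W$ be the equalizer of $\rho_V\otimes\mathrm{id}_W$ and $\mathrm{id}_V\otimes\lambda_W : V\otimes W\rightrightarrows V\otimes Q\otimes W$; $V$ is called coflat if the functor $V\,\square_Q -$ from left $Q$-comodules to $\mathscr{C}$ is exact. Let $H$ be a Hopf algebra in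 $\mathscr{C}$, with counit $\varepsilon_H$ and augmentation ideal $H^+=\operatorname{Ker}(\varepsilon_H: H\to\mathbf 1)$. Let $S^2_H(H^+)$ be the second symmetric power of the $H$-module $H^+$, i.e. the coequalizer of the identity and the symmetry on $H^+\otimes_H H^+$, and let $\mu_H: S^2_H(H^+)\to H^+$ be the morphism induced by the product $H^+\otimes H^+\to H^+$ of $H$. Then the following conditions are equivalent: (a) $H$ is smooth; (b) $H$, with its coproduct as coaction, is $H$-smooth; (c) $H$ is $Q$-smooth for every quotient Hopf algebra $Q$ of $H$ such that $H$ is coflat as a right $Q$-comodule, where $Q$ coacts through $H\to H\otimes H\to H\otimes Q$; (d) $\mu_H: S^2_H(H^+)\to H^+$ is a monomorphism. -/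

import Mathlib

open CategoryTheory MonoidalCategory Limits
open scoped MonObj ComonObj

universe v u

/-- Every object is a coproduct of simple objects. (Projections onto the summands embed the index
set into an endomorphism ring, so index sets in `Type v` are no restriction.) -/
def IsSemisimpleCategory (C : Type u) [Category.{v} C] [HasZeroMorphisms C] : Prop :=
  ∀ X : C, ∃ (J : Type v) (S : J → C) (c : Cofan S),
    (∀ j, Simple (S j)) ∧ Nonempty (IsColimit c) ∧ Nonempty (c.pt ≅ X)

noncomputable section

namespace HopfSmooth

variable {C : Type u} [Category.{v} C] [MonoidalCategory C]

section Nilpotent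

/-- The tensor power `I ⊗ ⋯ ⊗ I`. -/
def tensorPow (I : C) : ℕ → C
  | 0 => 𝟙_ C
  | n + 1 => tensorPow I n ⊗ I

/-- The `n`-fold product `I ⊗ ⋯ ⊗ I ⟶ R` of a subobject `i : I ⟶ R` of an algebra `R`; its image is
the power `Iⁿ` if `I` is an ideal. -/
def mulPow {I R : C} [MonObj R] (i : I ⟶ R) : ∀ n : ℕ, tensorPow I n ⟶ R
  | 0 => η[R]
  | n + 1 => (mulPow i n ⊗ₘ i) ≫ μ[R]

/-- `Iⁿ = 0` for some `n`. -/
def IsNilpotentIdeal [HasZeroMorphisms C] {I R : C} [MonObj R] (i : I ⟶ R) : Prop :=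
  ∃ n : ℕ, mulPow i n = 0

end Nilpotent

section Smooth

variable [BraidedCategory C] [HasZeroMorphisms C] [HasKernels C]

/-- Smoothness of an algebra `A`: algebra morphisms `A ⟶ R / I` lift to `R` for every commutative
algebra `R` and every nilpotent ideal `I` of `R`. The pairs `(I, R ⟶ R / I)` are given by algebra
morphisms `π : R ⟶ S` that are epic in `C`, with `I` the kernel of `π`. -/
def IsSmooth (A : C) [MonObj A] : Prop :=
  ∀ (R S : C) [MonObj R] [IsCommMonObj R] [MonObj S] [IsCommMonObj S]
    (π : R ⟶ S) [IsMonHom π] [Epi π], IsNilpotentIdeal (kernel.ι π) →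
    ∀ (f : A ⟶ S) [IsMonHom f], ∃ g : A ⟶ R, IsMonHom g ∧ g ≫ π = f

end Smooth

section Comodules

/-- Right comodules over a coalgebra `Q`. -/
structure RightComod (Q : C) [ComonObj Q] where
  /-- the underlying object -/
  X : C
  /-- the coaction -/
  coact : X ⟶ X ⊗ Q
  coact_counit : coact ≫ X ◁ ε[Q] = (ρ_ X).inv
  coact_comul : coact ≫ X ◁ Δ[Q] = coact ≫ coact ▷ Q ≫ (α_ X Q Q).hom

/-- Left comodules over a coalgebra `Q`. -/
structure LeftComod (Q : C) [ComonObj Q] where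
  /-- the underlying object -/
  X : C
  /-- the coaction -/
  coact : X ⟶ Q ⊗ X
  coact_counit : coact ≫ ε[Q] ▷ X = (λ_ X).inv
  coact_comul : coact ≫ Q ◁ coact = coact ≫ Δ[Q] ▷ X ≫ (α_ Q Q X).hom

/-- Colinear morphisms of left comodules. -/
@[ext]
structure LeftComod.Hom {Q : C} [ComonObj Q] (V W : LeftComod Q) where
  /-- the underlying morphism -/
  hom : V.X ⟶ W.X
  colinear : V.coact ≫ Q ◁ hom = hom ≫ W.coact

instance {Q : C} [ComonObj Q] : Category (LeftComod Q) where
  Hom V W := LeftComod.Hom V W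
  id V := ⟨𝟙 V.X, by simp⟩
  comp f g := ⟨f.hom ≫ g.hom, by
    rw [MonoidalCategory.whiskerLeft_comp, ← Category.assoc, f.colinear, Category.assoc,
      g.colinear, Category.assoc]⟩

variable [HasEqualizers C]

/-- The cotensor product `V □_Q W`. -/
def cotensorObj {Q : C} [ComonObj Q] (V : RightComod Q) (W : LeftComod Q) : C :=
  equalizer (V.coact ▷ W.X) (V.X ◁ W.coact ≫ (α_ V.X Q W.X).inv)

/-- The inclusion `V □_Q W ⟶ V ⊗ W`. -/
def cotensorι {Q : C} [ComonObj Q] (V : RightComod Q) (W : LeftComod Q) :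
    cotensorObj V W ⟶ V.X ⊗ W.X :=
  equalizer.ι (V.coact ▷ W.X) (V.X ◁ W.coact ≫ (α_ V.X Q W.X).inv)

lemma cotensorι_condition {Q : C} [ComonObj Q] (V : RightComod Q) (W : LeftComod Q) :
    cotensorι V W ≫ V.coact ▷ W.X = cotensorι V W ≫ V.X ◁ W.coact ≫ (α_ V.X Q W.X).inv :=
  equalizer.condition _ _

lemma cotensor_hom_ext {Q : C} [ComonObj Q] {V : RightComod Q} {W : LeftComod Q} {Z : C}
    {f g : Z ⟶ cotensorObj V W} (h : f ≫ cotensorι V W = g ≫ cotensorι V W) : f = g :=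
  equalizer.hom_ext h

/-- The morphism `V □_Q W ⟶ V □_Q W'` induced by a colinear morphism. -/
def cotensorMap {Q : C} [ComonObj Q] (V : RightComod Q) {W W' : LeftComod Q}
    (f : LeftComod.Hom W W') : cotensorObj V W ⟶ cotensorObj V W' :=
  equalizer.lift (cotensorι V W ≫ V.X ◁ f.hom) (by
    rw [Category.assoc, whisker_exchange, ← Category.assoc, cotensorι_condition, Category.assoc,
      Category.assoc, Category.assoc, ← MonoidalCategory.whiskerLeft_comp_assoc, ← f.colinear]
    simp)

lemma cotensorMap_ι {Q : C} [ComonObj Q] (V : RightComod Q) {W W' : LeftComod Q}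
    (f : LeftComod.Hom W W') :
    cotensorMap V f ≫ cotensorι V W' = cotensorι V W ≫ V.X ◁ f.hom :=
  equalizer.lift_ι _ _

/-- The functor `V □_Q -` from left `Q`-comodules. -/
def cotensor {Q : C} [ComonObj Q] (V : RightComod Q) : LeftComod Q ⥤ C where
  obj W := cotensorObj V W
  map f := cotensorMap V f
  map_id W := by
    apply cotensor_hom_ext
    rw [cotensorMap_ι]
    change _ ≫ V.X ◁ (𝟙 W.X) = _
    simp
  map_comp f g := by
    apply cotensor_hom_ext
    rw [cotensorMap_ι, Category.assoc, cotensorMap_ι, ← Category.assoc, cotensorMap_ι]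
    change _ ≫ V.X ◁ (f.hom ≫ g.hom) = _
    simp

/-- `V` is coflat if `V □_Q -` is exact, i.e. sends short exact sequences of left comodules (which
are the sequences of colinear morphisms that are short exact in `C`) to short exact sequences. -/
def IsCoflat [HasZeroMorphisms C] {Q : C} [ComonObj Q] (V : RightComod Q) : Prop :=
  ∀ (W₁ W₂ W₃ : LeftComod Q) (f : W₁ ⟶ W₂) (g : W₂ ⟶ W₃) (w : f.hom ≫ g.hom = 0),
    (ShortComplex.mk f.hom g.hom w).ShortExact →
    ∃ w' : (cotensor V).map f ≫ (cotensor V).map g = 0,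
      (ShortComplex.mk ((cotensor V).map f) ((cotensor V).map g) w').ShortExact

end Comodules

section ComoduleAlgebras

variable [BraidedCategory C]

/-- Commutative (right) `Q`-comodule algebras: the coaction is an algebra morphism. -/
structure ComodAlg (Q : C) [BimonObj Q] extends RightComod Q where
  [mon : MonObj X]
  [comm : IsCommMonObj X]
  [isMonHom_coact : IsMonHom coact]

attribute [instance] ComodAlg.mon ComodAlg.comm ComodAlg.isMonHom_coact

/-- Colinear algebra morphisms. -/
structure IsComodAlgHom {Q : C} [BimonObj Q] (A B : ComodAlg Q) (f : A.X ⟶ B.X) : Prop where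
  isMonHom : IsMonHom f
  colinear : A.coact ≫ f ▷ Q = f ≫ B.coact

/-- `Q`-smoothness of a `Q`-comodule algebra `A`: colinear algebra morphisms `A ⟶ R / I` lift to
colinear algebra morphisms `A ⟶ R` for every `Q`-comodule algebra `R` and every nilpotent
`Q`-costable ideal `I` of `R`; as in `IsSmooth`, `I` is the kernel of an epic `π : R ⟶ S`. -/
def ComodAlg.IsSmooth [HasZeroMorphisms C] [HasKernels C] {Q : C} [BimonObj Q]
    (A : ComodAlg Q) : Prop :=
  ∀ (R S : ComodAlg Q) (π : R.X ⟶ S.X) [Epi π], IsComodAlgHom R S π →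
    IsNilpotentIdeal (kernel.ι π) →
    ∀ f : A.X ⟶ S.X, IsComodAlgHom A S f → ∃ g : A.X ⟶ R.X, IsComodAlgHom A R g ∧ g ≫ π = f

instance isMonHom_comul (H : C) [BimonObj H] : IsMonHom Δ[H] where
  one_hom := BimonObj.one_comul H
  mul_hom := by rw [BimonObj.mul_comul]; simp [MonObj.tensorObj.mul_def]

/-- `H` as an `H`-comodule algebra, through the coproduct. -/
def ComodAlg.regular (H : C) [BimonObj H] [IsCommMonObj H] : ComodAlg H where
  X := H
  coact := Δ[H]
  coact_counit := ComonObj.comul_counit H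
  coact_comul := ComonObj.comul_assoc H

/-- `H` as a `Q`-comodule algebra, through a bialgebra morphism `q : H ⟶ Q`. -/
def ComodAlg.ofHom {H Q : C} [BimonObj H] [IsCommMonObj H] [BimonObj Q] (q : H ⟶ Q)
    [IsBimonHom q] : ComodAlg Q where
  X := H
  coact := Δ[H] ≫ H ◁ q
  coact_counit := by
    rw [Category.assoc, ← MonoidalCategory.whiskerLeft_comp, IsComonHom.hom_counit,
      ComonObj.comul_counit]
  coact_comul := by
    calc _ = Δ[H] ≫ H ◁ (q ≫ Δ[Q]) := by
          rw [MonoidalCategory.whiskerLeft_comp, Category.assoc]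
      _ = (Δ[H] ≫ H ◁ Δ[H]) ≫ H ◁ (q ⊗ₘ q) := by
        rw [IsComonHom.hom_comul, MonoidalCategory.whiskerLeft_comp, Category.assoc]
      _ = _ := by
        rw [ComonObj.comul_assoc]
        simp only [Category.assoc, comp_whiskerRight, whisker_exchange_assoc]
        simp [MonoidalCategory.tensorHom_def]
  isMonHom_coact := by
    have : IsMonHom (H ◁ q) := by
      rw [← id_tensorHom]; infer_instance
    infer_instance

end ComoduleAlgebras

section SymmetricSquare

variable [SymmetricCategory C] [HasCoequalizers C]

/-- The right action on a left module `M` over a (commutative) algebra `A`. -/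
def rightAct (A M : C) [MonObj A] [ModObj A M] : M ⊗ A ⟶ M :=
  (β_ M A).hom ≫ γ[A, M]

/-- The tensor product `M ⊗_A N` of modules over a commutative algebra. -/
def tensorOver (A M N : C) [MonObj A] [ModObj A M] [ModObj A N] : C :=
  coequalizer (rightAct A M ▷ N) ((α_ M A N).hom ≫ M ◁ γ[A, N])

/-- The projection `M ⊗ N ⟶ M ⊗_A N`. -/
def tensorOver.π (A M N : C) [MonObj A] [ModObj A M] [ModObj A N] :
    M ⊗ N ⟶ tensorOver A M N :=
  coequalizer.π _ _

lemma tensorOver.condition (A M N : C) [MonObj A] [ModObj A M] [ModObj A N] :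
    rightAct A M ▷ N ≫ tensorOver.π A M N =
      (α_ M A N).hom ≫ M ◁ γ[A, N] ≫ tensorOver.π A M N :=
  (coequalizer.condition _ _).trans (Category.assoc _ _ _)

/-- The symmetry `M ⊗_A N ⟶ N ⊗_A M`, induced by that of `C`. -/
def tensorOver.swap (A M N : C) [MonObj A] [ModObj A M] [ModObj A N] :
    tensorOver A M N ⟶ tensorOver A N M :=
  coequalizer.desc ((β_ M N).hom ≫ tensorOver.π A N M) (by
    have h₁ : N ◁ γ[A, M] ≫ tensorOver.π A N M =
        (α_ N A M).inv ≫ (β_ N A).hom ▷ M ≫ γ[A, N] ▷ M ≫ tensorOver.π A N M := by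
      rw [← comp_whiskerRight_assoc, ← rightAct, tensorOver.condition, Iso.inv_hom_id_assoc]
    have h₂ : (β_ (M ⊗ A) N).hom ≫ N ◁ (β_ M A).hom ≫ (α_ N A M).inv ≫ (β_ N A).hom ▷ M =
        (α_ M A N).hom ≫ (β_ M (A ⊗ N)).hom := by
      rw [← BraidedCategory.braiding_naturality_left_assoc]
      simp [BraidedCategory.braiding_tensor_left_hom, BraidedCategory.braiding_tensor_right_hom,
        ← comp_whiskerRight]
    calc _ = (β_ (M ⊗ A) N).hom ≫ N ◁ (β_ M A).hom ≫ N ◁ γ[A, M] ≫ tensorOver.π A N M := by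
          rw [BraidedCategory.braiding_naturality_left_assoc, rightAct]
          simp
      _ = (α_ M A N).hom ≫ (β_ M (A ⊗ N)).hom ≫ γ[A, N] ▷ M ≫ tensorOver.π A N M := by
          rw [h₁, ← Category.assoc (α_ M A N).hom, ← h₂]
          simp only [Category.assoc]
      _ = _ := by
          rw [Category.assoc, ← BraidedCategory.braiding_naturality_right_assoc])

lemma tensorOver.hom_ext {A M N : C} [MonObj A] [ModObj A M] [ModObj A N] {Z : C}
    {f g : tensorOver A M N ⟶ Z} (h : tensorOver.π A M N ≫ f = tensorOver.π A M N ≫ g) : f = g :=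
  coequalizer.hom_ext h

lemma tensorOver.π_swap (A M N : C) [MonObj A] [ModObj A M] [ModObj A N] :
    tensorOver.π A M N ≫ tensorOver.swap A M N = (β_ M N).hom ≫ tensorOver.π A N M :=
  coequalizer.π_desc _ _

/-- The second symmetric power `S²_A(M)`: the coinvariants of the symmetry on `M ⊗_A M`. -/
def symSq (A M : C) [MonObj A] [ModObj A M] : C :=
  coequalizer (𝟙 (tensorOver A M M)) (tensorOver.swap A M M)

end SymmetricSquare

section Mu

variable [Abelian C]

/-- The augmentation ideal `H⁺ = Ker ε`. -/
def augIdeal (H : C) [ComonObj H] : C := kernel ε[H]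

/-- The inclusion `H⁺ ⟶ H`. -/
def augIdeal.incl (H : C) [ComonObj H] : augIdeal H ⟶ H := kernel.ι ε[H]

instance (H : C) [ComonObj H] : Mono (augIdeal.incl H) :=
  inferInstanceAs (Mono (kernel.ι ε[H]))

lemma augIdeal.incl_counit (H : C) [ComonObj H] : augIdeal.incl H ≫ ε[H] = 0 :=
  kernel.condition _

variable [SymmetricCategory C] [MonoidalPreadditive C]

/-- The action of `H` on `H⁺`, the restriction of the product of `H`. -/
def augIdeal.act (H : C) [BimonObj H] : H ⊗ augIdeal H ⟶ augIdeal H :=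
  kernel.lift ε[H] (H ◁ augIdeal.incl H ≫ μ[H]) (by
    rw [Category.assoc, Bimon.mul_counit, tensorHom_def', ← Category.assoc, ← Category.assoc,
      ← MonoidalCategory.whiskerLeft_comp, augIdeal.incl_counit]
    simp)

lemma augIdeal.act_incl (H : C) [BimonObj H] :
    augIdeal.act H ≫ augIdeal.incl H = H ◁ augIdeal.incl H ≫ μ[H] :=
  kernel.lift_ι _ _ _

/-- `H⁺` as an `H`-module. -/
instance augIdeal.modObj (H : C) [BimonObj H] : ModObj H (augIdeal H) where
  smul := augIdeal.act H
  one_smul := by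
    rw [← cancel_mono (augIdeal.incl H)]
    change (η[H] ▷ augIdeal H ≫ augIdeal.act H) ≫ _ = (λ_ (augIdeal H)).hom ≫ _
    rw [Category.assoc, augIdeal.act_incl, ← whisker_exchange_assoc, MonObj.one_mul]
    simp
  mul_smul := by
    rw [← cancel_mono (augIdeal.incl H)]
    change (μ[H] ▷ augIdeal H ≫ augIdeal.act H) ≫ _ =
      ((α_ H H (augIdeal H)).hom ≫ H ◁ augIdeal.act H ≫ augIdeal.act H) ≫ _
    simp only [Category.assoc, augIdeal.act_incl]
    rw [← MonoidalCategory.whiskerLeft_comp_assoc, augIdeal.act_incl, ← whisker_exchange_assoc,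
      MonObj.mul_assoc]
    simp

/-- The product `H⁺ ⊗ H⁺ ⟶ H⁺`, the restriction of the product of `H`. -/
def augIdeal.mul (H : C) [BimonObj H] : augIdeal H ⊗ augIdeal H ⟶ augIdeal H :=
  augIdeal.incl H ▷ augIdeal H ≫ augIdeal.act H

lemma augIdeal.mul_incl (H : C) [BimonObj H] :
    augIdeal.mul H ≫ augIdeal.incl H = (augIdeal.incl H ⊗ₘ augIdeal.incl H) ≫ μ[H] := by
  rw [augIdeal.mul, Category.assoc, augIdeal.act_incl, MonoidalCategory.tensorHom_def, Category.assoc]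

variable (H : C) [BimonObj H] [IsCommMonObj H]

/-- The morphism `H⁺ ⊗_H H⁺ ⟶ H⁺` induced by the product. -/
def augIdeal.mulOver : tensorOver H (augIdeal H) (augIdeal H) ⟶ augIdeal H :=
  coequalizer.desc (augIdeal.mul H) (by
    have h : rightAct H (augIdeal H) ≫ augIdeal.incl H = augIdeal.incl H ▷ H ≫ μ[H] := by
      change ((β_ (augIdeal H) H).hom ≫ augIdeal.act H) ≫ _ = _
      rw [Category.assoc, augIdeal.act_incl, ← BraidedCategory.braiding_naturality_left_assoc,
        IsCommMonObj.mul_comm]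
    rw [← cancel_mono (augIdeal.incl H)]
    simp only [Category.assoc, augIdeal.mul_incl]
    calc _ = ((rightAct H (augIdeal H) ≫ augIdeal.incl H) ⊗ₘ augIdeal.incl H) ≫ μ[H] := by
          simp [MonoidalCategory.tensorHom_def]
      _ = ((augIdeal.incl H ⊗ₘ 𝟙 H) ⊗ₘ augIdeal.incl H) ≫ μ[H] ▷ H ≫ μ[H] := by
          rw [h, tensorHom_id, ← tensorHom_id μ[H], tensorHom_comp_tensorHom_assoc,
            Category.comp_id]
      _ = (α_ _ _ _).hom ≫ (augIdeal.incl H ⊗ₘ (augIdeal.act H ≫ augIdeal.incl H)) ≫ μ[H] := by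
          rw [MonObj.mul_assoc, augIdeal.act_incl, associator_naturality_assoc]
          simp [MonoidalCategory.tensorHom_def]
      _ = _ := by
          change _ = (α_ _ _ _).hom ≫ augIdeal H ◁ augIdeal.act H ≫ _
          simp [MonoidalCategory.tensorHom_def'])

lemma augIdeal.π_mulOver :
    tensorOver.π H (augIdeal H) (augIdeal H) ≫ augIdeal.mulOver H = augIdeal.mul H :=
  coequalizer.π_desc _ _

/-- The morphism `μ_H : S²_H(H⁺) ⟶ H⁺` induced by the product. -/
def muHom : symSq H (augIdeal H) ⟶ augIdeal H :=
  coequalizer.desc (augIdeal.mulOver H) (by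
    apply tensorOver.hom_ext
    rw [Category.id_comp, ← Category.assoc, tensorOver.π_swap, Category.assoc,
      augIdeal.π_mulOver]
    rw [← cancel_mono (augIdeal.incl H), Category.assoc, augIdeal.mul_incl,
      ← BraidedCategory.braiding_naturality_assoc, IsCommMonObj.mul_comm])

end Mu

end HopfSmooth

/-!
Semisimplicity enters through the splitting of all epimorphisms.

(a) ⇒ (d): the product `g⁺ · h⁺` in `S²_H(H⁺)` is a Hochschild 2-cocycle of `H`; it twists the
square-zero extension `H ⊞ S²_H(H⁺)`, and an algebra section of the twisted extension yields a
retraction of `μ_H`.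

(d) ⇒ (b): a nilpotent ideal may be assumed to have square zero. The fundamental theorem of Hopf
modules then reduces lifting colinear morphisms from `H` to correcting a section of an extension by
a square-zero ideal along a retraction of `μ_H`.

(b) ⇒ (c): `- □_Q H` is right adjoint to the restriction of comodule algebras along `H ⟶ Q`, and it
preserves epimorphisms by coflatness, the antipode turning left comodules into right ones.

(c) ⇒ (a): take for `Q` the trivial Hopf algebra `𝟙`.
-/

noncomputable section

namespace HopfSmooth

section Semisimple

variable {C : Type u} [Category.{v} C] [Abelian C]

lemma exists_lift_of_simple (hC : IsSemisimpleCategory C) {X Y T : C} [Simple T] (p : X ⟶ Y)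
    [Epi p] (y : T ⟶ Y) : ∃ x : T ⟶ X, x ≫ p = y := by
  obtain ⟨J, S, c, hS, ⟨hc⟩, ⟨e⟩⟩ := hC (pullback y p)
  obtain ⟨j, hj⟩ : ∃ j, c.inj j ≫ e.hom ≫ pullback.fst y p ≠ 0 := by
    by_contra! h
    have h₀ : e.hom ≫ pullback.fst y p = 0 :=
      Cofan.IsColimit.hom_ext hc _ _ fun j => by rw [h, comp_zero]
    refine id_nonzero T ?_
    rw [← cancel_epi (pullback.fst y p), ← cancel_epi e.hom, reassoc_of% h₀, zero_comp,
      comp_zero, comp_zero]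
  have := hS j
  have := isIso_of_hom_simple hj
  refine ⟨inv (c.inj j ≫ e.hom ≫ pullback.fst y p) ≫ c.inj j ≫ e.hom ≫ pullback.snd y p, ?_⟩
  simp only [Category.assoc, IsIso.inv_comp_eq, pullback.condition]

lemma splitEpiCategory_of_isSemisimpleCategory (hC : IsSemisimpleCategory C) :
    SplitEpiCategory C where
  isSplitEpi_of_epi {X Y} p _ := by
    obtain ⟨J, S, c, hS, ⟨hc⟩, ⟨e⟩⟩ := hC Y
    choose x hx using fun j =>
      have := hS j
      exists_lift_of_simple hC p (c.inj j ≫ e.hom)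
    exact IsSplitEpi.mk' ⟨e.inv ≫ Cofan.IsColimit.desc hc x, by
      rw [Category.assoc, Iso.inv_comp_eq, Category.comp_id]
      refine Cofan.IsColimit.hom_ext hc _ _ fun j => ?_
      rw [Cofan.IsColimit.fac_assoc, hx]⟩

end Semisimple

section SplitEpi

variable {C : Type u} [Category.{v} C] [SplitEpiCategory C]

instance projective_of_splitEpiCategory (X : C) : Projective X where
  factors f e _ := ⟨f ≫ section_ e (hf := isSplitEpi_of_epi e), by simp⟩

lemma exists_comp_eq_of_epi {W X Y : C} (p : X ⟶ Y) [Epi p] (y : W ⟶ Y) :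
    ∃ x : W ⟶ X, x ≫ p = y :=
  ⟨Projective.factorThru y p, Projective.factorThru_comp y p⟩

instance epi_whiskerRight [MonoidalCategory C] {X Y : C} (p : X ⟶ Y) [Epi p] (W : C) :
    Epi (p ▷ W) :=
  have := isSplitEpi_of_epi p
  inferInstanceAs (Epi ((tensorRight W).map p))

instance epi_tensorHom [MonoidalCategory C] {X Y X' Y' : C} (p : X ⟶ Y) (p' : X' ⟶ Y') [Epi p]
    [Epi p'] : Epi (p ⊗ₘ p') :=
  have := isSplitEpi_of_epi p'
  have : Epi (Y ◁ p') := inferInstanceAs (Epi ((tensorLeft Y).map p'))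
  MonoidalCategory.tensorHom_def p p' ▸ inferInstance

variable [Abelian C]

lemma isSplitMono_of_mono {X Y : C} (i : X ⟶ Y) [Mono i] : IsSplitMono i :=
  have h : (ShortComplex.mk i (cokernel.π i) (cokernel.condition i)).ShortExact :=
    { exact := ShortComplex.exact_cokernel i }
  h.splittingOfProjective.isSplitMono_f

lemma exists_comp_eq_of_mono {X Y Z : C} (i : X ⟶ Y) [Mono i] (x : X ⟶ Z) :
    ∃ y : Y ⟶ Z, i ≫ y = x :=
  have := isSplitMono_of_mono i
  ⟨retraction i ≫ x, by simp⟩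

lemma exists_comp_eq_of_comp_cokernel {X Y Z : C} (j : X ⟶ Y) (x : Z ⟶ Y)
    (hx : x ≫ cokernel.π j = 0) : ∃ l, l ≫ j = x :=
  ⟨_, (ShortComplex.exact_cokernel j).liftFromProjective_comp x hx⟩

variable [MonoidalCategory C] [MonoidalPreadditive C] (W : C)

lemma preservesFiniteLimits_and_colimits_tensorRight :
    PreservesFiniteLimits (tensorRight W) ∧ PreservesFiniteColimits (tensorRight W) := by
  refine ((tensorRight W).exact_tfae.out 0 3).1 fun S hS => ?_
  exact (hS.splittingOfProjective.map (tensorRight W)).shortExact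

instance : PreservesFiniteLimits (tensorRight W) :=
  (preservesFiniteLimits_and_colimits_tensorRight W).1

instance : PreservesFiniteColimits (tensorRight W) :=
  (preservesFiniteLimits_and_colimits_tensorRight W).2

instance mono_whiskerRight {X Y : C} (i : X ⟶ Y) [Mono i] : Mono (i ▷ W) :=
  inferInstanceAs (Mono ((tensorRight W).map i))

lemma exists_comp_kernel_whiskerRight {X Y Z : C} (p : X ⟶ Y) (z : Z ⟶ X ⊗ W)
    (hz : z ≫ p ▷ W = 0) : ∃ l, l ≫ kernel.ι p ▷ W = z := by
  have h := (ShortComplex.exact_kernel p).map (tensorRight W)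
  exact ⟨_, h.liftFromProjective_comp z hz⟩

lemma exists_comp_equalizer_whiskerRight {X Y Z : C} (a b : X ⟶ Y) (z : Z ⟶ X ⊗ W)
    (hz : z ≫ a ▷ W = z ≫ b ▷ W) : ∃ l, l ≫ equalizer.ι a b ▷ W = z :=
  ⟨_, (Fork.IsLimit.lift' (isLimitForkMapOfIsLimit (tensorRight W) (equalizer.condition a b)
    (equalizerIsEqualizer a b)) z hz).2⟩

end SplitEpi

/-- The external product `X ⊗ Y ⟶ T` of two morphisms to an algebra `T`; it turns identities between
products of elements into identities between morphisms. -/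
def extMul {C : Type u} [Category.{v} C] [MonoidalCategory C] {X Y T : C} [MonObj T] (a : X ⟶ T)
    (b : Y ⟶ T) : X ⊗ Y ⟶ T :=
  (a ⊗ₘ b) ≫ μ[T]

local infix:70 "⋆" => extMul

section ExternalProduct

variable {C : Type u} [Category.{v} C] [MonoidalCategory C] {X Y Z W X' Y' T U : C} [MonObj T]
  [MonObj U]

lemma tensorHom_extMul (x : X' ⟶ X) (y : Y' ⟶ Y) (a : X ⟶ T) (b : Y ⟶ T) :
    (x ⊗ₘ y) ≫ (a ⋆ b) = (x ≫ a) ⋆ (y ≫ b) := by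
  simp [extMul]

lemma whiskerRight_extMul (x : X' ⟶ X) (a : X ⟶ T) (b : Y ⟶ T) :
    x ▷ Y ≫ (a ⋆ b) = (x ≫ a) ⋆ b := by
  simp [extMul, MonoidalCategory.tensorHom_def]

lemma whiskerLeft_extMul (y : Y' ⟶ Y) (a : X ⟶ T) (b : Y ⟶ T) :
    X ◁ y ≫ (a ⋆ b) = a ⋆ (y ≫ b) := by
  simp [extMul, MonoidalCategory.tensorHom_def']

lemma extMul_comp (a : X ⟶ T) (b : Y ⟶ T) (φ : T ⟶ U) [IsMonHom φ] :
    (a ⋆ b) ≫ φ = (a ≫ φ) ⋆ (b ≫ φ) := by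
  simp [extMul, IsMonHom.mul_hom]

lemma id_extMul_id : 𝟙 T ⋆ 𝟙 T = μ[T] := by simp [extMul]

lemma extMul_assoc (a : X ⟶ T) (b : Y ⟶ T) (c : Z ⟶ T) :
    (a ⋆ b) ⋆ c = (α_ X Y Z).hom ≫ (a ⋆ (b ⋆ c)) := by
  have h₁ : (a ⋆ b) ⋆ c = ((a ⊗ₘ b) ⊗ₘ c) ≫ μ[T] ▷ T ≫ μ[T] := by
    rw [extMul, extMul, ← tensorHom_id, tensorHom_comp_tensorHom_assoc, Category.comp_id]
  have h₂ : a ⋆ (b ⋆ c) = (a ⊗ₘ (b ⊗ₘ c)) ≫ T ◁ μ[T] ≫ μ[T] := by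
    rw [extMul, extMul, ← id_tensorHom, tensorHom_comp_tensorHom_assoc, Category.comp_id]
  rw [h₁, h₂, MonObj.mul_assoc, associator_naturality_assoc]

lemma extMul_one (a : X ⟶ T) : a ⋆ η[T] = (ρ_ X).hom ≫ a := by
  simp [extMul, MonoidalCategory.tensorHom_def]

lemma one_extMul (a : X ⟶ T) : η[T] ⋆ a = (λ_ X).hom ≫ a := by
  simp [extMul, MonoidalCategory.tensorHom_def']

section Preadditive

variable [Preadditive C] [MonoidalPreadditive C]

lemma zero_extMul (b : Y ⟶ T) : (0 : X ⟶ T) ⋆ b = 0 := by simp [extMul]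

lemma extMul_zero (a : X ⟶ T) : a ⋆ (0 : Y ⟶ T) = 0 := by simp [extMul]

lemma add_extMul (a a' : X ⟶ T) (b : Y ⟶ T) : (a + a') ⋆ b = a ⋆ b + a' ⋆ b := by
  simp [extMul, MonoidalPreadditive.add_tensor]

lemma extMul_add (a : X ⟶ T) (b b' : Y ⟶ T) : a ⋆ (b + b') = a ⋆ b + a ⋆ b' := by
  simp [extMul, MonoidalPreadditive.tensor_add]

lemma sub_extMul (a a' : X ⟶ T) (b : Y ⟶ T) : (a - a') ⋆ b = a ⋆ b - a' ⋆ b := by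
  rw [eq_sub_iff_add_eq, ← add_extMul, sub_add_cancel]

lemma extMul_sub (a : X ⟶ T) (b b' : Y ⟶ T) : a ⋆ (b - b') = a ⋆ b - a ⋆ b' := by
  rw [eq_sub_iff_add_eq, ← extMul_add, sub_add_cancel]

end Preadditive

section Braided

variable [BraidedCategory C]

lemma extMul_comm [IsCommMonObj T] (a : X ⟶ T) (b : Y ⟶ T) :
    a ⋆ b = (β_ X Y).hom ≫ (b ⋆ a) := by
  rw [extMul, extMul, ← BraidedCategory.braiding_naturality_assoc, IsCommMonObj.mul_comm]

lemma tensorHom_extMul_tensorHom (a : X ⟶ T) (b : Y ⟶ U) (c : Z ⟶ T) (d : W ⟶ U) :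
    (a ⊗ₘ b) ⋆ (c ⊗ₘ d) = tensorμ X Y Z W ≫ ((a ⋆ c) ⊗ₘ (b ⋆ d)) := by
  simp only [extMul]
  rw [MonObj.tensorObj.mul_def, tensorμ_natural_assoc, tensorHom_comp_tensorHom]

end Braided

end ExternalProduct

section Augmentation

variable {C : Type u} [Category.{v} C] [MonoidalCategory C] [SymmetricCategory C] [Abelian C]
  (H : C) [BimonObj H]

/-- The projection `h ↦ h - ε(h)` onto the augmentation ideal. -/
def augProj : H ⟶ augIdeal H :=
  kernel.lift ε[H] (𝟙 H - ε[H] ≫ η[H]) (by simp)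

lemma augProj_incl : augProj H ≫ augIdeal.incl H = 𝟙 H - ε[H] ≫ η[H] :=
  kernel.lift_ι _ _ _

lemma one_augProj : η[H] ≫ augProj H = 0 := by
  rw [← cancel_mono (augIdeal.incl H), Category.assoc, augProj_incl]
  simp

lemma incl_augProj : augIdeal.incl H ≫ augProj H = 𝟙 _ := by
  rw [← cancel_mono (augIdeal.incl H), Category.assoc, augProj_incl]
  simp [reassoc_of% augIdeal.incl_counit H]

/-- The unital extension `h ↦ ε(h) + s(h - ε(h))` of a morphism `s` on the augmentation ideal. -/
def unitalExt {H R : C} [BimonObj H] [MonObj R] (s : augIdeal H ⟶ R) : H ⟶ R :=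
  ε[H] ≫ η[R] + augProj H ≫ s

lemma unitalExt_comp {H R S : C} [BimonObj H] [MonObj R] [MonObj S] (s : augIdeal H ⟶ R)
    (π : R ⟶ S) [IsMonHom π] (f : H ⟶ S) [IsMonHom f] (hs : s ≫ π = augIdeal.incl H ≫ f) :
    unitalExt s ≫ π = f := by
  rw [unitalExt, Preadditive.add_comp, Category.assoc, Category.assoc, hs,
    reassoc_of% augProj_incl]
  simp

variable [MonoidalPreadditive C]

lemma act_incl_eq_extMul : augIdeal.act H ≫ augIdeal.incl H = 𝟙 H ⋆ augIdeal.incl H := by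
  rw [augIdeal.act_incl, extMul, id_tensorHom]

lemma rightAct_incl_eq_extMul [IsCommMonObj H] :
    rightAct H (augIdeal H) ≫ augIdeal.incl H = augIdeal.incl H ⋆ 𝟙 H := by
  change ((β_ (augIdeal H) H).hom ≫ augIdeal.act H) ≫ _ = _
  rw [Category.assoc, act_incl_eq_extMul, ← extMul_comm]

lemma mul_incl_eq_extMul :
    augIdeal.mul H ≫ augIdeal.incl H = augIdeal.incl H ⋆ augIdeal.incl H :=
  augIdeal.mul_incl H

/-- With `h = h⁺ + ε(h)`, this is `(gh)⁺ = g⁺h⁺ + ε(g)h⁺ + g⁺ε(h)`. -/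
lemma mul_augProj : μ[H] ≫ augProj H = (augProj H ⊗ₘ augProj H) ≫ augIdeal.mul H +
    (ε[H] ⊗ₘ augProj H) ≫ (λ_ _).hom + (augProj H ⊗ₘ ε[H]) ≫ (ρ_ _).hom := by
  let e : H ⟶ H := ε[H] ≫ η[H]
  have h_counit : μ[H] ≫ e = e ⋆ e := by
    rw [← tensorHom_extMul, one_extMul, Bimon.mul_counit_assoc]
  have h_left : ((ε[H] ⊗ₘ augProj H) ≫ (λ_ _).hom) ≫ augIdeal.incl H = e ⋆ (𝟙 H - e) := by
    rw [← augProj_incl, ← tensorHom_extMul, one_extMul, Category.assoc]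
  have h_right : ((augProj H ⊗ₘ ε[H]) ≫ (ρ_ _).hom) ≫ augIdeal.incl H = (𝟙 H - e) ⋆ e := by
    rw [← augProj_incl, ← tensorHom_extMul, extMul_one, Category.assoc]
  have h_mul : ((augProj H ⊗ₘ augProj H) ≫ augIdeal.mul H) ≫ augIdeal.incl H =
      (𝟙 H - e) ⋆ (𝟙 H - e) := by
    rw [Category.assoc, mul_incl_eq_extMul, tensorHom_extMul, augProj_incl]
  rw [← cancel_mono (augIdeal.incl H), Preadditive.add_comp, Preadditive.add_comp, h_left, h_right,
    h_mul, Category.assoc, augProj_incl, Preadditive.comp_sub, Category.comp_id, h_counit,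
    ← id_extMul_id]
  simp only [extMul_sub, sub_extMul]
  abel

lemma isMonHom_unitalExt {H R : C} [BimonObj H] [MonObj R] (s : augIdeal H ⟶ R)
    (hs : s ⋆ s = augIdeal.mul H ≫ s) : IsMonHom (unitalExt s) where
  one_hom := by simp [unitalExt, reassoc_of% one_augProj H]
  mul_hom := by
    change _ = _ ⋆ _
    rw [unitalExt, Preadditive.comp_add, ← Category.assoc μ[H] (augProj H), mul_augProj]
    simp only [add_extMul, extMul_add, Preadditive.add_comp, Category.assoc, ← tensorHom_extMul,
      hs, one_extMul, extMul_one, Bimon.mul_counit_assoc, unitors_equal]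
    abel

end Augmentation

section SymSq

variable {C : Type u} [Category.{v} C] [MonoidalCategory C] [SymmetricCategory C]

section

variable [HasCoequalizers C] (A M : C) [MonObj A] [ModObj A M]

/-- The morphism out of `M ⊗_A M` given by a balanced morphism out of `M ⊗ M`. -/
def tensorOver.desc {A M Z : C} [MonObj A] [ModObj A M] (m : M ⊗ M ⟶ Z)
    (hm : rightAct A M ▷ M ≫ m = (α_ M A M).hom ≫ M ◁ γ[A, M] ≫ m) : tensorOver A M M ⟶ Z :=
  coequalizer.desc m (hm.trans (Category.assoc _ _ _).symm)

lemma tensorOver.π_desc {A M Z : C} [MonObj A] [ModObj A M] (m : M ⊗ M ⟶ Z)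
    (hm : rightAct A M ▷ M ≫ m = (α_ M A M).hom ≫ M ◁ γ[A, M] ≫ m) :
    tensorOver.π A M M ≫ tensorOver.desc m hm = m :=
  coequalizer.π_desc _ _

/-- The projection `M ⊗_A M ⟶ S²_A(M)`. -/
def symSq.π : tensorOver A M M ⟶ symSq A M :=
  coequalizer.π _ _

/-- The projection `M ⊗ M ⟶ S²_A(M)`. -/
def symSq.proj : M ⊗ M ⟶ symSq A M :=
  tensorOver.π A M M ≫ symSq.π A M

lemma symSq.swap_π : tensorOver.swap A M M ≫ symSq.π A M = symSq.π A M :=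
  (coequalizer.condition _ _).symm.trans (Category.id_comp _)

lemma symSq.braiding_proj : (β_ M M).hom ≫ symSq.proj A M = symSq.proj A M := by
  rw [symSq.proj, ← Category.assoc, ← tensorOver.π_swap, Category.assoc, symSq.swap_π]

lemma symSq.rightAct_proj : rightAct A M ▷ M ≫ symSq.proj A M =
    (α_ M A M).hom ≫ M ◁ γ[A, M] ≫ symSq.proj A M := by
  rw [symSq.proj, ← Category.assoc, tensorOver.condition]
  simp only [Category.assoc]

variable {A M} {Z : C}

lemma symSq.hom_ext {f g : symSq A M ⟶ Z} (h : symSq.proj A M ≫ f = symSq.proj A M ≫ g) :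
    f = g :=
  coequalizer.hom_ext (tensorOver.hom_ext
    ((Category.assoc _ _ _).symm.trans (h.trans (Category.assoc _ _ _))))

section Desc

variable (m : M ⊗ M ⟶ Z) (hm : rightAct A M ▷ M ≫ m = (α_ M A M).hom ≫ M ◁ γ[A, M] ≫ m)

lemma symSq.swap_tensorOver_desc (hs : (β_ M M).hom ≫ m = m) :
    tensorOver.swap A M M ≫ tensorOver.desc m hm = tensorOver.desc m hm := by
  apply tensorOver.hom_ext
  rw [← Category.assoc, tensorOver.π_swap, Category.assoc, tensorOver.π_desc, hs]

/-- The morphism out of `S²_A(M)` given by a balanced symmetric morphism out of `M ⊗ M`. -/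
def symSq.desc (hs : (β_ M M).hom ≫ m = m) : symSq A M ⟶ Z :=
  coequalizer.desc (tensorOver.desc m hm)
    ((Category.id_comp _).trans (symSq.swap_tensorOver_desc m hm hs).symm)

lemma symSq.proj_desc (hs : (β_ M M).hom ≫ m = m) :
    symSq.proj A M ≫ symSq.desc m hm hs = m := by
  have h : symSq.π A M ≫ symSq.desc m hm hs = tensorOver.desc m hm := coequalizer.π_desc _ _
  rw [symSq.proj, Category.assoc, h, tensorOver.π_desc]

end Desc

end

lemma symSq.proj_muHom [Abelian C] [MonoidalPreadditive C] (H : C) [BimonObj H]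
    [IsCommMonObj H] : symSq.proj H (augIdeal H) ≫ muHom H = augIdeal.mul H := by
  have h : symSq.π H (augIdeal H) ≫ muHom H = augIdeal.mulOver H := coequalizer.π_desc _ _
  rw [symSq.proj, Category.assoc, h, augIdeal.π_mulOver]

end SymSq

section TrivialExtension

variable {C : Type u} [Category.{v} C] [MonoidalCategory C] [Abelian C] {R S : C}
  [MonObj R]

/-- The kernel of `π` has square zero. -/
def IsSquareZero (π : R ⟶ S) : Prop := kernel.ι π ⋆ kernel.ι π = 0

lemma extMul_eq_zero_of_kernel {X Y : C} {π : R ⟶ S} {x : X ⟶ R} (hx : x ≫ π = 0) {y : Y ⟶ R}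
    (h : kernel.ι π ⋆ y = 0) : x ⋆ y = 0 := by
  rw [← kernel.lift_ι π x hx, ← whiskerRight_extMul, h, comp_zero]

lemma IsSquareZero.extMul_eq_zero [SymmetricCategory C] [IsCommMonObj R] {X Y : C}
    {π : R ⟶ S} (hπ : IsSquareZero π) {x : X ⟶ R}
    (hx : x ≫ π = 0) {y : Y ⟶ R} (hy : y ≫ π = 0) : x ⋆ y = 0 :=
  extMul_eq_zero_of_kernel hx (by
    rw [extMul_comm, extMul_eq_zero_of_kernel hy hπ, comp_zero])

variable [MonoidalPreadditive C]

lemma extMul_congr_of_kernel {X Y : C} {π : R ⟶ S} {y : Y ⟶ R} (h : kernel.ι π ⋆ y = 0)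
    {x x' : X ⟶ R} (hx : x ≫ π = x' ≫ π) : x ⋆ y = x' ⋆ y := by
  rw [← sub_eq_zero, ← sub_extMul]
  exact extMul_eq_zero_of_kernel (by rw [Preadditive.sub_comp, hx, sub_self]) h

variable [SymmetricCategory C] [IsCommMonObj R]

variable {H : C} [BimonObj H] [IsCommMonObj H] [MonObj S] {π : R ⟶ S} [IsMonHom π] {σ : H ⟶ R}
  [IsMonHom (σ ≫ π)]

lemma rightAct_extMul_of_kernel (hσ : kernel.ι π ⋆ (augIdeal.incl H ≫ σ) = 0) :
    rightAct H (augIdeal H) ▷ augIdeal H ≫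
        ((augIdeal.incl H ≫ σ) ⋆ (augIdeal.incl H ≫ σ)) =
      (α_ _ H _).hom ≫ augIdeal H ◁ γ[H, augIdeal H] ≫
        ((augIdeal.incl H ≫ σ) ⋆ (augIdeal.incl H ≫ σ)) := by
  let i := augIdeal.incl H ≫ σ
  have h_right : (rightAct H (augIdeal H) ≫ i) ≫ π = (i ⋆ σ) ≫ π := by
    have h := rightAct_incl_eq_extMul H
    simp only [extMul_comp, i, Category.assoc, reassoc_of% h, Category.id_comp]
  have h_left : (augIdeal.act H ≫ i) ≫ π = (σ ⋆ i) ≫ π := by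
    have h := act_incl_eq_extMul H
    simp only [extMul_comp, i, Category.assoc, reassoc_of% h, Category.id_comp]
  calc _ = (i ⋆ σ) ⋆ i := by rw [whiskerRight_extMul, extMul_congr_of_kernel hσ h_right]
    _ = (α_ _ _ _).hom ≫ (i ⋆ (σ ⋆ i)) := extMul_assoc _ _ _
    _ = (α_ _ _ _).hom ≫ (i ⋆ (augIdeal.act H ≫ i)) := by
      rw [extMul_comm i, extMul_comm i, extMul_congr_of_kernel hσ h_left]
    _ = _ := by rw [← whiskerLeft_extMul]; rfl

/-- The products of elements of `σ(H⁺)` define a morphism on `S²_H(H⁺)`; extending it along `μ_H`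
corrects `σ` to an algebra morphism. -/
theorem exists_isMonHom_lift_of_kernel [SplitEpiCategory C] [Mono (muHom H)]
    (hπ : IsSquareZero π) (hσ : kernel.ι π ⋆ (augIdeal.incl H ≫ σ) = 0) :
    ∃ g : H ⟶ R, IsMonHom g ∧ g ≫ π = σ ≫ π := by
  let i := augIdeal.incl H ≫ σ
  let m := symSq.desc (i ⋆ i) (rightAct_extMul_of_kernel hσ) (extMul_comm i i).symm
  have hm : symSq.proj H _ ≫ m = i ⋆ i := symSq.proj_desc _ _ _
  have h_mπ : m ≫ π = (muHom H ≫ i) ≫ π := by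
    have h₁ := symSq.proj_muHom H
    have h₂ := mul_incl_eq_extMul H
    apply symSq.hom_ext
    rw [reassoc_of% hm, Category.assoc, reassoc_of% h₁, Category.assoc, reassoc_of% h₂,
      extMul_comp, extMul_comp, Category.assoc]
  obtain ⟨d, hd⟩ := exists_comp_eq_of_mono (muHom H)
    (kernel.lift π (m - muHom H ≫ i) (by rw [Preadditive.sub_comp, h_mπ, sub_self]))
  let s := i + d ≫ kernel.ι π
  have h_s : muHom H ≫ s = m := by
    rw [Preadditive.comp_add, reassoc_of% hd, kernel.lift_ι, add_sub_cancel]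
  have h_sπ : s ≫ π = augIdeal.incl H ≫ σ ≫ π := by simp [s, i]
  have h_sq : s ⋆ s = i ⋆ i := by
    have h_di : (d ≫ kernel.ι π) ⋆ i = 0 := extMul_eq_zero_of_kernel (by simp) hσ
    have h_dd : (d ≫ kernel.ι π) ⋆ (d ≫ kernel.ι π) = 0 := hπ.extMul_eq_zero (by simp) (by simp)
    rw [add_extMul, extMul_add, extMul_add, h_di, h_dd, extMul_comm i (d ≫ _), h_di, comp_zero,
      add_zero, add_zero, add_zero]
  refine ⟨unitalExt s, isMonHom_unitalExt s ?_, unitalExt_comp s π _ h_sπ⟩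
  rw [h_sq, ← hm, ← h_s, ← Category.assoc, symSq.proj_muHom]

end TrivialExtension

section CocycleExtension

variable {C : Type u} [Category.{v} C] [MonoidalCategory C]

/-- The external product of a scalar with a morphism. -/
def scalarMul {X Y V : C} (s : X ⟶ 𝟙_ C) (v : Y ⟶ V) : X ⊗ Y ⟶ V :=
  (s ⊗ₘ v) ≫ (λ_ V).hom

/-- The external product of a morphism with a scalar. -/
def mulScalar {X Y V : C} (v : X ⟶ V) (s : Y ⟶ 𝟙_ C) : X ⊗ Y ⟶ V :=
  (v ⊗ₘ s) ≫ (ρ_ V).hom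

variable {X Y Z V W : C}

lemma scalarMul_scalarMul (s : X ⟶ 𝟙_ C) (t : Y ⟶ 𝟙_ C) (v : Z ⟶ V) :
    scalarMul (scalarMul s t) v = (α_ _ _ _).hom ≫ scalarMul s (scalarMul t v) := by
  simp [scalarMul, MonoidalCategory.tensorHom_def]

lemma mulScalar_scalarMul (s : X ⟶ 𝟙_ C) (v : Y ⟶ V) (t : Z ⟶ 𝟙_ C) :
    mulScalar (scalarMul s v) t = (α_ _ _ _).hom ≫ scalarMul s (mulScalar v t) := by
  simp only [scalarMul, mulScalar, MonoidalCategory.tensorHom_def]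
  monoidal

lemma mulScalar_mulScalar (v : X ⟶ V) (s : Y ⟶ 𝟙_ C) (t : Z ⟶ 𝟙_ C) :
    mulScalar (mulScalar v s) t = (α_ _ _ _).hom ≫ mulScalar v (scalarMul s t) := by
  simp [scalarMul, mulScalar, MonoidalCategory.tensorHom_def, unitors_equal]

lemma tensorHom_scalarMul (x : X ⟶ W) (y : Y ⟶ Z) (s : W ⟶ 𝟙_ C) (v : Z ⟶ V) :
    (x ⊗ₘ y) ≫ scalarMul s v = scalarMul (x ≫ s) (y ≫ v) := by
  simp [scalarMul]

lemma tensorHom_mulScalar (x : X ⟶ W) (y : Y ⟶ Z) (v : W ⟶ V) (s : Z ⟶ 𝟙_ C) :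
    (x ⊗ₘ y) ≫ mulScalar v s = mulScalar (x ≫ v) (y ≫ s) := by
  simp [mulScalar]

lemma scalarMul_tensorHom {X' Y' : C} (s : X ⟶ 𝟙_ C) (v : Y ⟶ X') (w : Z ⟶ Y') :
    scalarMul s v ⊗ₘ w = (α_ _ _ _).hom ≫ scalarMul s (v ⊗ₘ w) := by
  simp only [scalarMul, MonoidalCategory.tensorHom_def]
  monoidal

lemma mulScalar_tensorHom {X' Y' : C} (v : X ⟶ X') (s : Y ⟶ 𝟙_ C) (w : Z ⟶ Y') :
    mulScalar v s ⊗ₘ w = (α_ _ _ _).hom ≫ (v ⊗ₘ scalarMul s w) := by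
  simp only [scalarMul, mulScalar, MonoidalCategory.tensorHom_def]
  monoidal

lemma tensorHom_mulScalar_eq {X' Y' : C} (v : X ⟶ X') (w : Y ⟶ Y') (s : Z ⟶ 𝟙_ C) :
    mulScalar (v ⊗ₘ w) s = (α_ _ _ _).hom ≫ (v ⊗ₘ mulScalar w s) := by
  simp only [mulScalar, MonoidalCategory.tensorHom_def]
  monoidal

lemma scalarMul_comp (s : X ⟶ 𝟙_ C) (v : Y ⟶ V) (f : V ⟶ W) :
    scalarMul s (v ≫ f) = scalarMul s v ≫ f := by
  simp [scalarMul, MonoidalCategory.tensorHom_def]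

lemma mulScalar_comp (v : X ⟶ V) (s : Y ⟶ 𝟙_ C) (f : V ⟶ W) :
    mulScalar (v ≫ f) s = mulScalar v s ≫ f := by
  simp [mulScalar, MonoidalCategory.tensorHom_def']

section Preadditive

variable [Preadditive C] [MonoidalPreadditive C]

lemma scalarMul_add (s : X ⟶ 𝟙_ C) (v v' : Y ⟶ V) :
    scalarMul s (v + v') = scalarMul s v + scalarMul s v' := by
  simp [scalarMul, MonoidalPreadditive.tensor_add]

lemma add_mulScalar (v v' : X ⟶ V) (s : Y ⟶ 𝟙_ C) :
    mulScalar (v + v') s = mulScalar v s + mulScalar v' s := by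
  simp [mulScalar, MonoidalPreadditive.add_tensor]

end Preadditive

variable [Preadditive C] [SymmetricCategory C] {H : C} [BimonObj H]

/-- Normalized symmetric Hochschild 2-cocycles of `H` with values in `V`, on which `H` acts through
the counit. -/
structure IsSymmCocycle (F : H ⊗ H ⟶ V) : Prop where
  one_left : η[H] ▷ H ≫ F = 0
  symm : (β_ H H).hom ≫ F = F
  cocycle : μ[H] ▷ H ≫ F + mulScalar F ε[H] =
    (α_ H H H).hom ≫ (H ◁ μ[H] ≫ F + scalarMul ε[H] F)

lemma IsSymmCocycle.one_right {F : H ⊗ H ⟶ V} (hF : IsSymmCocycle F) : H ◁ η[H] ≫ F = 0 := by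
  rw [← hF.symm, BraidedCategory.braiding_naturality_right_assoc, hF.one_left, comp_zero]

lemma IsSymmCocycle.tensorHom_cocycle {F : H ⊗ H ⟶ V} (hF : IsSymmCocycle F) (x : X ⟶ H)
    (y : Y ⟶ H) (z : Z ⟶ H) :
    ((x ⋆ y) ⊗ₘ z) ≫ F + mulScalar ((x ⊗ₘ y) ≫ F) (z ≫ ε[H]) =
      (α_ X Y Z).hom ≫ ((x ⊗ₘ (y ⋆ z)) ≫ F + scalarMul (x ≫ ε[H]) ((y ⊗ₘ z) ≫ F)) := by
  have h := congrArg (((x ⊗ₘ y) ⊗ₘ z) ≫ ·) hF.cocycle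
  simpa only [extMul, Preadditive.comp_add, associator_naturality_assoc, tensorHom_mulScalar,
    tensorHom_scalarMul, ← tensorHom_id, ← id_tensorHom, tensorHom_comp_tensorHom_assoc,
    Category.comp_id] using h

variable [HasBinaryBiproducts C]

namespace cocycleExt

/-- The second component `F(a, b) + ε(a) w + v ε(b)` of the product of `(a, v)` and `(b, w)`. -/
def mulSnd (F : H ⊗ H ⟶ V) : (H ⊞ V) ⊗ (H ⊞ V) ⟶ V :=
  (biprod.fst ⊗ₘ biprod.fst) ≫ F + scalarMul (biprod.fst ≫ ε[H]) biprod.snd +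
    mulScalar biprod.snd (biprod.fst ≫ ε[H])

lemma tensorHom_mulSnd (F : H ⊗ H ⟶ V) (x : X ⟶ H ⊞ V) (y : Y ⟶ H ⊞ V) :
    (x ⊗ₘ y) ≫ mulSnd F = ((x ≫ biprod.fst) ⊗ₘ (y ≫ biprod.fst)) ≫ F +
      scalarMul (x ≫ biprod.fst ≫ ε[H]) (y ≫ biprod.snd) +
      mulScalar (x ≫ biprod.snd) (y ≫ biprod.fst ≫ ε[H]) := by
  simp [mulSnd, tensorHom_scalarMul, tensorHom_mulScalar]

/-- The product of the algebra `H ⊞ V`. -/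
def mul (F : H ⊗ H ⟶ V) : (H ⊞ V) ⊗ (H ⊞ V) ⟶ H ⊞ V :=
  biprod.lift (biprod.fst ⋆ biprod.fst) (mulSnd F)

lemma mul_fst (F : H ⊗ H ⟶ V) : mul F ≫ biprod.fst = biprod.fst ⋆ biprod.fst :=
  biprod.lift_fst _ _

lemma mul_snd (F : H ⊗ H ⟶ V) : mul F ≫ biprod.snd = mulSnd F :=
  biprod.lift_snd _ _

variable {F : H ⊗ H ⟶ V} (hF : IsSymmCocycle F)

include hF in
lemma braiding_mul [IsCommMonObj H] : (β_ _ _).hom ≫ mul F = mul F := by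
  ext
  · rw [Category.assoc, mul_fst, ← extMul_comm]
  · simp only [Category.assoc, mul_snd, mulSnd, Preadditive.comp_add, scalarMul, mulScalar,
      ← BraidedCategory.braiding_naturality_assoc, hF.symm, braiding_leftUnitor,
      braiding_rightUnitor]
    abel

variable [MonoidalPreadditive C]

include hF in
lemma one_mul : biprod.lift η[H] 0 ▷ (H ⊞ V) ≫ mul F = (λ_ _).hom := by
  ext
  · rw [Category.assoc, mul_fst, whiskerRight_extMul, biprod.lift_fst, one_extMul]
  · rw [Category.assoc, mul_snd, ← tensorHom_id, tensorHom_mulSnd, biprod.lift_fst,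
      MonoidalCategory.tensorHom_def', Category.assoc, hF.one_left]
    simp [scalarMul, mulScalar]

include hF in
lemma mul_one : (H ⊞ V) ◁ biprod.lift η[H] 0 ≫ mul F = (ρ_ _).hom := by
  ext
  · rw [Category.assoc, mul_fst, whiskerLeft_extMul, biprod.lift_fst, extMul_one]
  · rw [Category.assoc, mul_snd, ← id_tensorHom, tensorHom_mulSnd, biprod.lift_fst,
      MonoidalCategory.tensorHom_def, Category.assoc, hF.one_right]
    simp [scalarMul, mulScalar]

include hF in
lemma mul_assoc : mul F ▷ (H ⊞ V) ≫ mul F = (α_ _ _ _).hom ≫ (H ⊞ V) ◁ mul F ≫ mul F := by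
  ext
  · simp only [Category.assoc, mul_fst, whiskerRight_extMul, whiskerLeft_extMul, extMul_assoc]
  · let p : H ⊞ V ⟶ H := biprod.fst
    have h_counit : (p ⋆ p) ≫ ε[H] = scalarMul (p ≫ ε[H]) (p ≫ ε[H]) := by
      rw [extMul, Category.assoc, Bimon.mul_counit, tensorHom_comp_tensorHom_assoc, scalarMul]
    have h_cocycle := eq_sub_of_add_eq (hF.tensorHom_cocycle p p p)
    simp only [Category.assoc, mul_snd]
    rw [← tensorHom_id, ← id_tensorHom, tensorHom_mulSnd, tensorHom_mulSnd]
    simp only [reassoc_of% mul_fst F, mul_fst, mul_snd, Category.id_comp]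
    rw [mulSnd]
    simp only [p] at h_counit h_cocycle
    simp only [h_cocycle, h_counit, scalarMul_add, add_mulScalar, Preadditive.comp_add,
      scalarMul_scalarMul, mulScalar_scalarMul, mulScalar_mulScalar]
    abel

end cocycleExt

variable [MonoidalPreadditive C] {F : H ⊗ H ⟶ V} (hF : IsSymmCocycle F)

/-- The algebra `H ⊞ V` with product twisted by a cocycle. -/
@[reducible]
def cocycleExt : MonObj (H ⊞ V) where
  one := biprod.lift η[H] 0
  mul := cocycleExt.mul F
  one_mul := cocycleExt.one_mul hF
  mul_one := cocycleExt.mul_one hF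
  mul_assoc := cocycleExt.mul_assoc hF

lemma isCommMonObj_cocycleExt [IsCommMonObj H] :
    letI := cocycleExt hF
    IsCommMonObj (H ⊞ V) :=
  letI := cocycleExt hF
  { mul_comm := cocycleExt.braiding_mul hF }

lemma isMonHom_cocycleExt_fst :
    letI := cocycleExt hF
    IsMonHom (biprod.fst : H ⊞ V ⟶ H) :=
  letI := cocycleExt hF
  { one_hom := biprod.lift_fst _ _
    mul_hom := cocycleExt.mul_fst F }

lemma cocycleExt_extMul_snd (x : X ⟶ H ⊞ V) (y : Y ⟶ H ⊞ V) :
    letI := cocycleExt hF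
    (x ⋆ y) ≫ biprod.snd = ((x ≫ biprod.fst) ⊗ₘ (y ≫ biprod.fst)) ≫ F +
      scalarMul (x ≫ biprod.fst ≫ ε[H]) (y ≫ biprod.snd) +
      mulScalar (x ≫ biprod.snd) (y ≫ biprod.fst ≫ ε[H]) := by
  let _ := cocycleExt hF
  rw [extMul, Category.assoc, ← cocycleExt.tensorHom_mulSnd]
  exact congrArg _ (cocycleExt.mul_snd F)

end CocycleExtension

section SmoothImpliesMono

variable {C : Type u} [Category.{v} C] [MonoidalCategory C] [Abelian C]

lemma IsSquareZero.isNilpotentIdeal {R S : C} [MonObj R] {π : R ⟶ S} (hπ : IsSquareZero π) :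
    IsNilpotentIdeal (kernel.ι π) := by
  have h : mulPow (kernel.ι π) 1 = (λ_ _).hom ≫ kernel.ι π := one_extMul _
  have h_sq : ((λ_ _).hom ≫ kernel.ι π) ⋆ kernel.ι π = 0 := by
    rw [← whiskerRight_extMul, hπ, comp_zero]
  exact ⟨2, (congrArg (· ⋆ kernel.ι π) h).trans h_sq⟩

variable [SymmetricCategory C] [MonoidalPreadditive C]

lemma isSquareZero_cocycleExt_fst {H V : C} [BimonObj H] {F : H ⊗ H ⟶ V}
    (hF : IsSymmCocycle F) :
    letI := cocycleExt hF
    IsSquareZero (biprod.fst : H ⊞ V ⟶ H) := by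
  let _ := cocycleExt hF
  have := isMonHom_cocycleExt_fst hF
  have h₀ : kernel.ι (biprod.fst : H ⊞ V ⟶ H) ≫ biprod.fst = 0 := kernel.condition _
  change _ ⋆ _ = 0
  ext
  · rw [extMul_comp, h₀, zero_extMul, zero_comp]
  · rw [cocycleExt_extMul_snd hF, reassoc_of% h₀, h₀]
    simp [scalarMul, mulScalar]

variable (H : C) [BimonObj H] [IsCommMonObj H]

lemma mul_whiskerRight_proj : augIdeal.mul H ▷ augIdeal H ≫ symSq.proj H (augIdeal H) =
    (α_ _ _ _).hom ≫ augIdeal H ◁ augIdeal.mul H ≫ symSq.proj H (augIdeal H) := by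
  have h_mul : augIdeal.mul H = augIdeal H ◁ augIdeal.incl H ≫ rightAct H (augIdeal H) := by
    rw [← cancel_mono (augIdeal.incl H), mul_incl_eq_extMul, Category.assoc,
      rightAct_incl_eq_extMul, whiskerLeft_extMul, Category.comp_id]
  have h_balanced := symSq.rightAct_proj H (augIdeal H)
  change _ = (α_ _ _ _).hom ≫ _ ◁ augIdeal.act H ≫ _ at h_balanced
  conv_lhs => rw [h_mul]
  rw [comp_whiskerRight, Category.assoc, h_balanced, augIdeal.mul]
  simp

/-- The class of `g⁺ ⊗ h⁺` in `S²_H(H⁺)`: the universal obstruction to lifting `H`. -/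
def symSqCocycle : H ⊗ H ⟶ symSq H (augIdeal H) :=
  (augProj H ⊗ₘ augProj H) ≫ symSq.proj H (augIdeal H)

lemma isSymmCocycle_symSqCocycle : IsSymmCocycle (symSqCocycle H) where
  one_left := by
    rw [symSqCocycle, ← tensorHom_id, tensorHom_comp_tensorHom_assoc, one_augProj]
    simp
  symm := by
    rw [symSqCocycle, ← BraidedCategory.braiding_naturality_assoc, symSq.braiding_proj]
  cocycle := by
    have h_mul : μ[H] ≫ augProj H = (augProj H ⊗ₘ augProj H) ≫ augIdeal.mul H +
      scalarMul ε[H] (augProj H) + mulScalar (augProj H) ε[H] := mul_augProj H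
    have h_assoc := congrArg (((augProj H ⊗ₘ augProj H) ⊗ₘ augProj H) ≫ ·)
      (mul_whiskerRight_proj H)
    simp only [← tensorHom_id, ← id_tensorHom, tensorHom_comp_tensorHom_assoc, Category.comp_id,
      associator_naturality_assoc] at h_assoc
    rw [symSqCocycle, ← tensorHom_id, ← id_tensorHom, tensorHom_comp_tensorHom_assoc,
      tensorHom_comp_tensorHom_assoc, h_mul]
    simp only [Category.id_comp, MonoidalPreadditive.add_tensor, MonoidalPreadditive.tensor_add,
      Preadditive.add_comp, Preadditive.comp_add, scalarMul_tensorHom, mulScalar_tensorHom,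
      tensorHom_mulScalar_eq, scalarMul_comp, mulScalar_comp, Category.assoc, h_assoc]
    abel

theorem mono_muHom_of_isSmooth (h : IsSmooth H) : Mono (muHom H) := by
  have hF := isSymmCocycle_symSqCocycle H
  let _ := cocycleExt hF
  have := isCommMonObj_cocycleExt hF
  have := isMonHom_cocycleExt_fst hF
  obtain ⟨g, _, hg⟩ := h _ _ biprod.fst (isSquareZero_cocycleExt_fst hF).isNilpotentIdeal (𝟙 H)
  have h_incl : (augIdeal.incl H ≫ g) ≫ biprod.fst = augIdeal.incl H := by
    rw [Category.assoc, hg, Category.comp_id]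
  have h_counit : (augIdeal.incl H ≫ g) ≫ biprod.fst ≫ ε[H] = 0 := by
    rw [Category.assoc, reassoc_of% hg, augIdeal.incl_counit]
  have h_mul : augIdeal.mul H ≫ augIdeal.incl H ≫ g ≫ biprod.snd = symSq.proj H (augIdeal H) := by
    have h := mul_incl_eq_extMul H
    rw [reassoc_of% h, ← Category.assoc, extMul_comp, cocycleExt_extMul_snd hF, h_incl, h_counit,
      symSqCocycle, tensorHom_comp_tensorHom_assoc, incl_augProj]
    simp [scalarMul, mulScalar]
  have h_retraction : muHom H ≫ augIdeal.incl H ≫ g ≫ biprod.snd = 𝟙 _ := by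
    have h := symSq.proj_muHom H
    apply symSq.hom_ext
    rw [reassoc_of% h, h_mul, Category.comp_id]
  exact mono_of_mono_fac h_retraction

end SmoothImpliesMono

section Quotient

variable {C : Type u} [Category.{v} C] [MonoidalCategory C] [SplitEpiCategory C]

lemma isMonHom_of_epi_comp {R R' S : C} [MonObj R] [MonObj R'] [MonObj S] (c : R ⟶ R') [Epi c]
    [IsMonHom c] (π : R' ⟶ S) (h : IsMonHom (c ≫ π)) : IsMonHom π where
  one_hom := by rw [← IsMonHom.one_hom c, Category.assoc, IsMonHom.one_hom]
  mul_hom := by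
    rw [← cancel_epi (c ⊗ₘ c), ← IsMonHom.mul_hom_assoc c, IsMonHom.mul_hom,
      tensorHom_comp_tensorHom_assoc]

section Transport

variable {R R' : C} [MonObj R] (c : R ⟶ R') [Epi c] (m : R' ⊗ R' ⟶ R')

/-- The algebra structure on `R'` with product `m`, for an epimorphism `c` from an algebra that
carries products to `m`. -/
@[reducible]
def monObjOfEpi (hm : (c ⊗ₘ c) ≫ m = μ[R] ≫ c) : MonObj R' where
  one := η[R] ≫ c
  mul := m
  one_mul := by
    rw [← cancel_epi (𝟙 (𝟙_ C) ⊗ₘ c), ← tensorHom_id, tensorHom_comp_tensorHom_assoc,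
      Category.id_comp, Category.comp_id, ← Category.id_comp c, ← tensorHom_comp_tensorHom_assoc,
      Category.id_comp, hm, tensorHom_id, MonObj.one_mul_assoc]
    simp
  mul_one := by
    rw [← cancel_epi (c ⊗ₘ 𝟙 (𝟙_ C)), ← id_tensorHom, tensorHom_comp_tensorHom_assoc,
      Category.id_comp, Category.comp_id, ← Category.id_comp c, ← tensorHom_comp_tensorHom_assoc,
      Category.id_comp, hm, id_tensorHom, MonObj.mul_one_assoc]
    simp
  mul_assoc := by
    rw [← cancel_epi ((c ⊗ₘ c) ⊗ₘ c), ← tensorHom_id, ← id_tensorHom,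
      tensorHom_comp_tensorHom_assoc, hm, Category.comp_id, associator_naturality_assoc,
      tensorHom_comp_tensorHom_assoc, hm, Category.comp_id]
    nth_rw 2 [← Category.id_comp c]
    nth_rw 3 [← Category.id_comp c]
    rw [← tensorHom_comp_tensorHom_assoc, ← tensorHom_comp_tensorHom_assoc, hm, tensorHom_id,
      id_tensorHom, MonObj.mul_assoc_assoc]

lemma isMonHom_monObjOfEpi (hm : (c ⊗ₘ c) ≫ m = μ[R] ≫ c) :
    letI := monObjOfEpi c m hm
    IsMonHom c :=
  let _ := monObjOfEpi c m hm
  { one_hom := rfl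
    mul_hom := hm.symm }

end Transport

lemma isCommMonObj_of_epi [BraidedCategory C] {R R' : C} [MonObj R] [IsCommMonObj R] [MonObj R']
    (c : R ⟶ R') [Epi c] [IsMonHom c] : IsCommMonObj R' where
  mul_comm := by
    rw [← cancel_epi (c ⊗ₘ c), BraidedCategory.braiding_naturality_assoc, ← IsMonHom.mul_hom,
      IsCommMonObj.mul_comm_assoc]

lemma exists_monObj_cokernel [Abelian C] [MonoidalPreadditive C] [BraidedCategory C] {R J : C}
    [MonObj R] [IsCommMonObj R] (j : J ⟶ R) (hj : ∃ l, l ≫ j = j ⋆ 𝟙 R) :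
    ∃ _ : MonObj (cokernel j), IsCommMonObj (cokernel j) ∧ IsMonHom (cokernel.π j) := by
  let c := cokernel.π j
  have h_ideal {X Y : C} (x : X ⟶ R) (y : Y ⟶ R) (hx : x ≫ c = 0) : (x ⋆ y) ≫ c = 0 := by
    obtain ⟨x', rfl⟩ := exists_comp_eq_of_comp_cokernel j x hx
    obtain ⟨l, hl⟩ := hj
    rw [← whiskerRight_extMul, ← Category.comp_id y, ← whiskerLeft_extMul, ← hl]
    simp [c]
  have h_left {X Y : C} (x x' : X ⟶ R) (y : Y ⟶ R) (h : x ≫ c = x' ≫ c) :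
      (x ⋆ y) ≫ c = (x' ⋆ y) ≫ c := by
    rw [← sub_eq_zero, ← Preadditive.sub_comp, ← sub_extMul]
    exact h_ideal _ _ (by rw [Preadditive.sub_comp, h, sub_self])
  have h_right {X Y : C} (x x' : X ⟶ R) (y : Y ⟶ R) (h : x ≫ c = x' ≫ c) :
      (y ⋆ x) ≫ c = (y ⋆ x') ≫ c := by
    rw [extMul_comm, extMul_comm y, Category.assoc, h_left x x' y h, Category.assoc]
  obtain ⟨s, hs⟩ := exists_comp_eq_of_epi c (𝟙 _)
  have h_mul : (c ⊗ₘ c) ≫ (s ⋆ s) ≫ c = μ[R] ≫ c := by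
    rw [reassoc_of% tensorHom_extMul, h_left _ (𝟙 R) _ (by simp [hs]),
      h_right _ (𝟙 R) _ (by simp [hs]), id_extMul_id]
  let _ := monObjOfEpi c ((s ⋆ s) ≫ c) h_mul
  have := isMonHom_monObjOfEpi c ((s ⋆ s) ≫ c) h_mul
  exact ⟨inferInstance, isCommMonObj_of_epi c, this⟩

end Quotient

section Comodule

variable {C : Type u} [Category.{v} C] [MonoidalCategory C] [SplitEpiCategory C]

section

variable [Abelian C] [MonoidalPreadditive C] {Q : C} [ComonObj Q]

/-- The subobject `i` of a comodule, with the restricted coaction `r`. -/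
def RightComod.ofMono (R : RightComod Q) {X : C} (i : X ⟶ R.X) [Mono i] (r : X ⟶ X ⊗ Q)
    (hr : r ≫ i ▷ Q = i ≫ R.coact) : RightComod Q where
  X := X
  coact := r
  coact_counit := by
    rw [← cancel_mono (i ▷ 𝟙_ C), Category.assoc, whisker_exchange, reassoc_of% hr,
      R.coact_counit, rightUnitor_inv_naturality]
  coact_comul := by
    rw [← cancel_mono (i ▷ (Q ⊗ Q)), Category.assoc, whisker_exchange, reassoc_of% hr,
      R.coact_comul]
    simp only [Category.assoc]
    rw [← associator_naturality_left, ← comp_whiskerRight_assoc, hr, comp_whiskerRight_assoc,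
      reassoc_of% hr]

lemma exists_kernel_coact {R S : RightComod Q} (π : R.X ⟶ S.X)
    (hπ : R.coact ≫ π ▷ Q = π ≫ S.coact) :
    ∃ r : kernel π ⟶ kernel π ⊗ Q, r ≫ kernel.ι π ▷ Q = kernel.ι π ≫ R.coact :=
  exists_comp_kernel_whiskerRight Q π _ (by
    rw [Category.assoc, hπ, kernel.condition_assoc, zero_comp])

end

variable [BraidedCategory C] {Q : C} [BimonObj Q]

/-- The quotient `c` of a comodule algebra, with the induced coaction `r`. -/
def ComodAlg.ofEpi (R : ComodAlg Q) {R' : C} [MonObj R'] [IsCommMonObj R'] (c : R.X ⟶ R')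
    [IsMonHom c] [Epi c] (r : R' ⟶ R' ⊗ Q) (hr : R.coact ≫ c ▷ Q = c ≫ r) : ComodAlg Q where
  X := R'
  coact := r
  coact_counit := by
    rw [← cancel_epi c, ← reassoc_of% hr, ← whisker_exchange, reassoc_of% R.coact_counit,
      rightUnitor_inv_naturality]
  coact_comul := by
    have h : c ≫ r ≫ r ▷ Q = R.coact ≫ R.coact ▷ Q ≫ c ▷ Q ▷ Q := by
      rw [← reassoc_of% hr, ← comp_whiskerRight, ← hr, comp_whiskerRight]
    rw [← cancel_epi c, ← reassoc_of% hr, ← whisker_exchange, reassoc_of% R.coact_comul,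
      reassoc_of% h]
    simp
  isMonHom_coact := isMonHom_of_epi_comp c r (by rw [← hr]; infer_instance)

lemma IsComodAlgHom.of_epi_comp {R R' S : ComodAlg Q} {c : R.X ⟶ R'.X} [Epi c] {π : R'.X ⟶ S.X}
    (hc : IsComodAlgHom R R' c) (hcπ : IsComodAlgHom R S (c ≫ π)) : IsComodAlgHom R' S π where
  isMonHom := have := hc.isMonHom; isMonHom_of_epi_comp c π hcπ.isMonHom
  colinear := by
    rw [← cancel_epi c, ← reassoc_of% hc.colinear, ← comp_whiskerRight, hcπ.colinear,
      Category.assoc]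

lemma ComodAlg.exists_quotient [Abelian C] [MonoidalPreadditive C] (R : ComodAlg Q) {J : C}
    (j : J ⟶ R.X) (hj : ∃ l, l ≫ j = j ⋆ 𝟙 R.X) (hj' : ∃ r, r ≫ j ▷ Q = j ≫ R.coact) :
    ∃ (R' : ComodAlg Q) (c : R.X ⟶ R'.X) (w : j ≫ c = 0), Epi c ∧ IsComodAlgHom R R' c ∧
      (ShortComplex.mk j c w).Exact := by
  obtain ⟨_, _, hc⟩ := exists_monObj_cokernel j hj
  have hr : j ≫ R.coact ≫ cokernel.π j ▷ Q = 0 := by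
    obtain ⟨r, hr⟩ := hj'
    rw [← reassoc_of% hr, ← comp_whiskerRight, cokernel.condition,
      MonoidalPreadditive.zero_whiskerRight, comp_zero]
  have h_coact := (cokernel.π_desc _ _ hr).symm
  exact ⟨R.ofEpi _ _ h_coact, cokernel.π j, cokernel.condition j,
    inferInstanceAs (Epi (cokernel.π j)), ⟨hc, h_coact⟩, ShortComplex.exact_cokernel j⟩

end Comodule

section HopfModule

open scoped HopfObj

variable {C : Type u} [Category.{v} C] [MonoidalCategory C]

/-- Right Hopf modules over a bialgebra `H`: right `H`-comodules with a right `H`-action that is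
colinear for the diagonal coaction on `X ⊗ H`. -/
structure HopfModule [BraidedCategory C] (H : C) [BimonObj H] extends RightComod H where
  /-- the action -/
  act : X ⊗ H ⟶ X
  act_one : X ◁ η[H] ≫ act = (ρ_ X).hom
  act_mul : act ▷ H ≫ act = (α_ X H H).hom ≫ X ◁ μ[H] ≫ act
  act_coact : act ≫ coact = (coact ⊗ₘ Δ[H]) ≫ tensorμ X H H H ≫ (act ⊗ₘ μ[H])

namespace HopfModule

section

variable [BraidedCategory C] {H : C} [HopfObj H] (M : HopfModule H)

/-- The projection `x ↦ x₀ 𝒮(x₁)` onto the coinvariants. -/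
def coinvProj : M.X ⟶ M.X :=
  M.coact ≫ M.X ◁ 𝒮[H] ≫ M.act

lemma coact_coinvProj_act : M.coact ≫ M.coinvProj ▷ H ≫ M.act = 𝟙 M.X := by
  calc _ = (M.coact ≫ M.coact ▷ H ≫ (α_ _ _ _).hom) ≫ M.X ◁ (𝒮[H] ▷ H ≫ μ[H]) ≫ M.act := by
        simp [coinvProj, M.act_mul]
    _ = M.coact ≫ M.X ◁ (ε[H] ≫ η[H]) ≫ M.act := by
        have h := HopfObj.antipode_left H
        rw [← M.coact_comul, Category.assoc, ← MonoidalCategory.whiskerLeft_comp_assoc, h]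
    _ = _ := by
        have h := M.coact_counit
        rw [MonoidalCategory.whiskerLeft_comp_assoc, M.act_one, reassoc_of% h, Iso.inv_hom_id]

lemma tensorμ_act_mul_act [IsCommMonObj H] :
    tensorμ M.X H H H ≫ (M.act ⊗ₘ μ[H]) ≫ M.act = (M.act ⊗ₘ μ[H]) ≫ M.act := by
  have h_act : (M.act ⊗ₘ μ[H]) ≫ M.act =
      (α_ M.X H (H ⊗ H)).hom ≫ M.X ◁ (H ◁ μ[H] ≫ μ[H]) ≫ M.act := by
    rw [MonoidalCategory.tensorHom_def', Category.assoc, M.act_mul]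
    simp
  have h_mul : (α_ H H H).inv ≫ (β_ H H).hom ▷ H ≫ (α_ H H H).hom ≫ H ◁ μ[H] ≫ μ[H] =
      H ◁ μ[H] ≫ μ[H] := by
    rw [← MonObj.mul_assoc, ← comp_whiskerRight_assoc, IsCommMonObj.mul_comm,
      MonObj.mul_assoc, Iso.inv_hom_id_assoc]
  rw [h_act, tensorμ]
  simp only [Category.assoc, Iso.inv_hom_id_assoc, ← MonoidalCategory.whiskerLeft_comp_assoc]
  rw [h_mul]

lemma act_coinvProj [IsCommMonObj H] :
    M.act ≫ M.coinvProj = M.X ◁ ε[H] ≫ (ρ_ M.X).hom ≫ M.coinvProj := by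
  have h_antipode : μ[H] ≫ 𝒮[H] = (𝒮[H] ⊗ₘ 𝒮[H]) ≫ μ[H] := by
    rw [HopfObj.mul_antipode, IsCommMonObj.mul_comm]
  have h := HopfObj.antipode_right H
  calc _ = (M.coact ⊗ₘ Δ[H]) ≫ tensorμ M.X H H H ≫ (M.act ⊗ₘ (μ[H] ≫ 𝒮[H])) ≫ M.act := by
        rw [coinvProj, reassoc_of% M.act_coact, ← id_tensorHom, tensorHom_comp_tensorHom_assoc,
          Category.comp_id]
    _ = ((M.coact ≫ M.X ◁ 𝒮[H]) ⊗ₘ (Δ[H] ≫ H ◁ 𝒮[H])) ≫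
          tensorμ M.X H H H ≫ (M.act ⊗ₘ μ[H]) ≫ M.act := by
        rw [h_antipode, ← tensorHom_comp_tensorHom_assoc, ← id_tensorHom, ← id_tensorHom,
          tensorμ_natural_assoc]
        rw [tensorHom_comp_tensorHom_assoc, id_tensorHom_id, Category.id_comp]
    _ = (M.coinvProj ⊗ₘ (ε[H] ≫ η[H])) ≫ M.act := by
        rw [tensorμ_act_mul_act, tensorHom_comp_tensorHom_assoc, Category.assoc, Category.assoc, h,
          coinvProj]
    _ = _ := by
        rw [MonoidalCategory.tensorHom_def', MonoidalCategory.whiskerLeft_comp]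
        simp only [Category.assoc, whisker_exchange_assoc, M.act_one]
        rw [← whisker_exchange_assoc, rightUnitor_naturality]

variable {M' : C} (c : M.X ⟶ M')

lemma act_coact_comp (hc : M.act ≫ c = M.X ◁ ε[H] ≫ (ρ_ M.X).hom ≫ c) :
    M.act ≫ M.coact ≫ c ▷ H = (M.coact ≫ c ▷ H) ▷ H ≫ (α_ _ _ _).hom ≫ M' ◁ μ[H] := by
  calc _ = (M.coact ⊗ₘ Δ[H]) ≫ tensorμ M.X H H H ≫ ((M.act ≫ c) ⊗ₘ μ[H]) := by
        rw [reassoc_of% M.act_coact, ← tensorHom_id, tensorHom_comp_tensorHom, Category.comp_id]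
    _ = (M.coact ⊗ₘ (Δ[H] ≫ ε[H] ▷ H)) ≫ tensorμ M.X H (𝟙_ C) H ≫
          (((ρ_ M.X).hom ≫ c) ⊗ₘ μ[H]) := by
        rw [hc]
        conv_rhs => rw [← Category.comp_id M.coact, ← id_tensorHom_id, ← tensorHom_id,
          ← tensorHom_comp_tensorHom, Category.assoc, tensorμ_natural_assoc,
          tensorHom_comp_tensorHom, id_tensorHom, id_tensorHom_id, Category.id_comp]
    _ = _ := by
        rw [ComonObj.counit_comul]
        simp only [tensorμ, braiding_tensorUnit_right, MonoidalCategory.tensorHom_def]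
        monoidal

lemma coinvProj_coact_comp
    (hc : M.act ≫ M.coact ≫ c ▷ H = (M.coact ≫ c ▷ H) ▷ H ≫ (α_ _ _ _).hom ≫ M' ◁ μ[H]) :
    M.coinvProj ≫ M.coact ≫ c ▷ H = c ≫ (ρ_ M').inv ≫ M' ◁ η[H] := by
  have h := HopfObj.antipode_right H
  calc _ = (M.coact ≫ M.coact ▷ H ≫ (α_ _ _ _).hom) ≫ M.X ◁ (H ◁ 𝒮[H] ≫ μ[H]) ≫ c ▷ H := by
        rw [coinvProj, Category.assoc, Category.assoc, hc]
        simp only [comp_whiskerRight, Category.assoc, whisker_exchange_assoc, tensor_whiskerLeft,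
          MonoidalCategory.whiskerLeft_comp]
        rw [associator_naturality_left_assoc, Iso.inv_hom_id_assoc, ← whisker_exchange]
    _ = M.coact ≫ M.X ◁ (ε[H] ≫ η[H]) ≫ c ▷ H := by
        rw [← M.coact_comul, Category.assoc, ← MonoidalCategory.whiskerLeft_comp_assoc, h]
    _ = _ := by
        have h := M.coact_counit
        rw [MonoidalCategory.whiskerLeft_comp_assoc, reassoc_of% h]
        simp [whisker_exchange]

end

/-- The fundamental theorem of Hopf modules: `c` is the projection of a Hopf module `M` onto
`M / M H⁺`, which `coinvProj` identifies with the coinvariants of `M`. -/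
theorem isIso_coact_comp [Abelian C] [MonoidalPreadditive C] [SplitEpiCategory C]
    [SymmetricCategory C] {H : C} [HopfObj H] [IsCommMonObj H] (M : HopfModule H) {M' : C}
    (c : M.X ⟶ M') [Epi c] (w : (M.X ◁ augIdeal.incl H ≫ M.act) ≫ c = 0)
    (hc : (ShortComplex.mk _ c w).Exact) : IsIso (M.coact ≫ c ▷ H) := by
  have h_act : M.act ≫ c = M.X ◁ ε[H] ≫ (ρ_ M.X).hom ≫ c := by
    have h_id : 𝟙 H = augProj H ≫ augIdeal.incl H + ε[H] ≫ η[H] := by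
      rw [augProj_incl, sub_add_cancel]
    rw [← Category.id_comp M.act, ← MonoidalCategory.whiskerLeft_id, h_id]
    simp only [MonoidalPreadditive.whiskerLeft_add, MonoidalCategory.whiskerLeft_comp,
      Preadditive.add_comp, Category.assoc] at w ⊢
    rw [w, comp_zero, zero_add, reassoc_of% M.act_one]
  have h_coinv : (M.X ◁ augIdeal.incl H ≫ M.act) ≫ M.coinvProj = 0 := by
    rw [Category.assoc, M.act_coinvProj, ← MonoidalCategory.whiskerLeft_comp_assoc,
      augIdeal.incl_counit, MonoidalPreadditive.whiskerLeft_zero, zero_comp]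
  let p := hc.desc M.coinvProj h_coinv
  have h_p : c ≫ p = M.coinvProj := hc.g_desc _ _
  have h_coact := M.act_coact_comp c h_act
  refine ⟨p ▷ H ≫ M.act, ?_, ?_⟩
  · rw [Category.assoc, ← comp_whiskerRight_assoc, h_p, M.coact_coinvProj_act]
  · rw [← cancel_epi (c ▷ H), Category.assoc,
      ← comp_whiskerRight_assoc, h_p, h_coact, ← comp_whiskerRight_assoc,
      M.coinvProj_coact_comp c h_coact]
    simp [← MonoidalCategory.whiskerLeft_comp]

end HopfModule

end HopfModule

section SquareZeroLifting

variable {C : Type u} [Category.{v} C]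

lemma isPullback_of_epi_of_kernel [Abelian C] [SplitEpiCategory C] {P X Y Z : C} {fst : P ⟶ X}
    {snd : P ⟶ Y} {f : X ⟶ Z} {g : Y ⟶ Z} [Epi snd] (w : fst ≫ f = snd ≫ g)
    (h_mono : ∀ {T : C} (x : T ⟶ P), x ≫ fst = 0 → x ≫ snd = 0 → x = 0)
    (h_lift : ∀ {T : C} (z : T ⟶ X), z ≫ f = 0 → ∃ l : T ⟶ P, l ≫ snd = 0 ∧ l ≫ fst = z) :
    IsPullback fst snd f g := by
  have h_exists (s : PullbackCone f g) : ∃ l, l ≫ fst = s.fst ∧ l ≫ snd = s.snd := by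
    obtain ⟨y, hy⟩ := exists_comp_eq_of_epi snd s.snd
    obtain ⟨l, h_snd, h_fst⟩ := h_lift (s.fst - y ≫ fst) (by
      rw [Preadditive.sub_comp, Category.assoc, w, reassoc_of% hy, s.condition, sub_self])
    exact ⟨y + l, by rw [Preadditive.add_comp, h_fst, add_sub_cancel],
      by rw [Preadditive.add_comp, hy, h_snd, add_zero]⟩
  choose l h_fst h_snd using h_exists
  refine ⟨⟨w⟩, ⟨PullbackCone.IsLimit.mk w l h_fst h_snd fun s m hm_fst hm_snd => ?_⟩⟩
  rw [← sub_eq_zero]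
  exact h_mono _ (by rw [Preadditive.sub_comp, hm_fst, h_fst, sub_self])
    (by rw [Preadditive.sub_comp, hm_snd, h_snd, sub_self])

section

variable [Abelian C] {R R' S : C} {c : R ⟶ R'} {π : R ⟶ S} {π' : R' ⟶ S} (hc : c ≫ π' = π)

lemma epi_kernel_lift_comp [SplitEpiCategory C] [Epi c] :
    Epi (kernel.lift π' (kernel.ι π ≫ c) (by simp [hc])) := by
  obtain ⟨x, hx⟩ := exists_comp_eq_of_epi c (kernel.ι π')
  have h_section : kernel.lift π x (by rw [← hc, reassoc_of% hx, kernel.condition]) ≫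
      kernel.lift π' (kernel.ι π ≫ c) (by simp [hc]) = 𝟙 _ := by
    ext
    simp [hx]
  exact epi_of_epi_fac h_section

lemma exact_kernel_lift_comp {J : C} {f : J ⟶ kernel π} {w : (f ≫ kernel.ι π) ≫ c = 0}
    (h : (ShortComplex.mk (f ≫ kernel.ι π) c w).Exact) :
    ∃ w', (ShortComplex.mk f (kernel.lift π' (kernel.ι π ≫ c) (by simp [hc])) w').Exact := by
  refine ⟨by ext; simpa using w, (ShortComplex.exact_iff_exact_up_to_refinements _).2
    fun A x hx => ?_⟩
  obtain ⟨A', p, hp, y, hy⟩ := h.exact_up_to_refinements (x ≫ kernel.ι π)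
    (by simpa using hx =≫ kernel.ι π')
  exact ⟨A', p, hp, y, by simpa [← cancel_mono (kernel.ι π)] using hy⟩

end

lemma isMonHom_of_isPullback [MonoidalCategory C] {P X Y Z A : C} [MonObj P] [MonObj X] [MonObj Y]
    [MonObj A] {fst : P ⟶ X} {snd : P ⟶ Y} {f : X ⟶ Z} {g : Y ⟶ Z} [IsMonHom fst] [IsMonHom snd]
    (h : IsPullback fst snd f g) (a : A ⟶ P) (h_fst : IsMonHom (a ≫ fst))
    (h_snd : IsMonHom (a ≫ snd)) : IsMonHom a where
  one_hom := h.hom_ext (by rw [Category.assoc, IsMonHom.one_hom, IsMonHom.one_hom])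
    (by rw [Category.assoc, IsMonHom.one_hom, IsMonHom.one_hom])
  mul_hom := h.hom_ext
    (by rw [Category.assoc, IsMonHom.mul_hom, Category.assoc, IsMonHom.mul_hom,
      tensorHom_comp_tensorHom_assoc])
    (by rw [Category.assoc, IsMonHom.mul_hom, Category.assoc, IsMonHom.mul_hom,
      tensorHom_comp_tensorHom_assoc])

variable [MonoidalCategory C] [Abelian C] [MonoidalPreadditive C] [SplitEpiCategory C]

lemma isPullback_of_isIso_kernel {Q : C} [ComonObj Q] {R S : RightComod Q} {π : R.X ⟶ S.X}
    [Epi π] (hπ : R.coact ≫ π ▷ Q = π ≫ S.coact) {r : kernel π ⟶ kernel π ⊗ Q}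
    (hr : r ≫ kernel.ι π ▷ Q = kernel.ι π ≫ R.coact)
    {R' : C} {c : R.X ⟶ R'} {π' : R' ⟶ S.X} (hcπ : c ≫ π' = π)
    [IsIso (r ≫ kernel.lift π' (kernel.ι π ≫ c) (by simp [hcπ]) ▷ Q)] :
    IsPullback (R.coact ≫ c ▷ Q) π (π' ▷ Q) S.coact := by
  let cK : kernel π ⟶ kernel π' := kernel.lift π' (kernel.ι π ≫ c) (by simp [hcπ])
  let i : kernel π ⟶ kernel π' ⊗ Q := r ≫ cK ▷ Q
  have : IsIso i := ‹_›
  have h_i : kernel.ι π ≫ R.coact ≫ c ▷ Q = i ≫ kernel.ι π' ▷ Q := by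
    rw [← reassoc_of% hr, Category.assoc, ← comp_whiskerRight, ← comp_whiskerRight,
      kernel.lift_ι]
  refine isPullback_of_epi_of_kernel ?_ (fun x h_fst h_snd => ?_) fun z hz => ?_
  · rw [Category.assoc, ← comp_whiskerRight, hcπ, hπ]
  · obtain ⟨y, rfl⟩ : ∃ y, y ≫ kernel.ι π = x := ⟨kernel.lift π x h_snd, kernel.lift_ι _ _ _⟩
    rw [Category.assoc, h_i] at h_fst
    rw [zero_of_comp_mono _ h_fst, zero_comp]
  · obtain ⟨l, rfl⟩ := exists_comp_kernel_whiskerRight Q π' z hz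
    exact ⟨l ≫ inv i ≫ kernel.ι π, by simp, by simp [h_i]⟩

/-- An algebra morphism `g' : A ⟶ R'` is the same as a colinear algebra morphism from `A` to the
cofree comodule algebra `R' ⊗ Q`. -/
lemma ComodAlg.exists_lift_of_isPullback [BraidedCategory C] {Q : C} [BimonObj Q]
    {A R S : ComodAlg Q} {π : R.X ⟶ S.X} (hπ : IsComodAlgHom R S π) {R' : C} [MonObj R']
    {c : R.X ⟶ R'} [IsMonHom c] {π' : R' ⟶ S.X}
    (h : IsPullback (R.coact ≫ c ▷ Q) π (π' ▷ Q) S.coact) {f : A.X ⟶ S.X}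
    (hf : IsComodAlgHom A S f) {g' : A.X ⟶ R'} (hg' : IsMonHom g') (hgf : g' ≫ π' = f) :
    ∃ g : A.X ⟶ R.X, IsComodAlgHom A R g ∧ g ≫ π = f := by
  have := hπ.isMonHom
  let g := h.lift (A.coact ≫ g' ▷ Q) f (by
    rw [Category.assoc, ← comp_whiskerRight, hgf, hf.colinear])
  have h_fst : g ≫ R.coact ≫ c ▷ Q = A.coact ≫ g' ▷ Q := h.lift_fst _ _ _
  have h_snd : g ≫ π = f := h.lift_snd _ _ _
  have h_coact {B : ComodAlg Q} {B' : C} (b : B.X ⟶ B') :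
      B.coact ≫ (B.coact ≫ b ▷ Q) ▷ Q = (B.coact ≫ b ▷ Q) ≫ B' ◁ Δ[Q] ≫ (α_ _ _ _).inv := by
    have h := B.coact_comul
    rw [Category.assoc, ← whisker_exchange_assoc, reassoc_of% h]
    simp
  refine ⟨g, ⟨isMonHom_of_isPullback h g (h_fst ▸ inferInstance) (h_snd ▸ hf.isMonHom),
    (h.map (tensorRight Q)).hom_ext ?_ ?_⟩, h_snd⟩
  · change (A.coact ≫ g ▷ Q) ≫ (R.coact ≫ c ▷ Q) ▷ Q = (g ≫ R.coact) ≫ (R.coact ≫ c ▷ Q) ▷ Q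
    rw [Category.assoc, ← comp_whiskerRight, h_fst, Category.assoc, h_coact, h_coact, ← h_fst,
      Category.assoc g]
  · change (A.coact ≫ g ▷ Q) ≫ π ▷ Q = (g ≫ R.coact) ≫ π ▷ Q
    rw [Category.assoc, ← comp_whiskerRight, h_snd, hf.colinear, ← h_snd, Category.assoc,
      Category.assoc, hπ.colinear]

variable [SymmetricCategory C]

lemma IsSquareZero.whiskerRight {R S : C} [MonObj R] {π : R ⟶ S} (hπ : IsSquareZero π) (U : C)
    [MonObj U] : IsSquareZero (π ▷ U) := by
  obtain ⟨l, hl⟩ := exists_comp_kernel_whiskerRight U π _ (kernel.condition (π ▷ U))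
  have h_sq : (kernel.ι π ▷ U) ⋆ (kernel.ι π ▷ U) = 0 := by
    rw [← tensorHom_id, tensorHom_extMul_tensorHom, hπ]
    simp
  rw [IsSquareZero, ← hl, ← tensorHom_extMul, h_sq, comp_zero]

end SquareZeroLifting

section KernelHopfModule

variable {C : Type u} [Category.{v} C] [MonoidalCategory C] [Abelian C] [MonoidalPreadditive C]

lemma IsSquareZero.extMul_congr [SymmetricCategory C] {R S X Y : C} [MonObj R] [IsCommMonObj R]
    {π : R ⟶ S} (hπ : IsSquareZero π) {x : X ⟶ R} (hx : x ≫ π = 0) {y y' : Y ⟶ R}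
    (hy : y ≫ π = y' ≫ π) :
    x ⋆ y = x ⋆ y' := by
  rw [← sub_eq_zero, ← extMul_sub]
  exact hπ.extMul_eq_zero hx (by rw [Preadditive.sub_comp, hy, sub_self])

section Action

variable {H R S : C} [MonObj R] [MonObj S] (π : R ⟶ S) [IsMonHom π] (σ : H ⟶ R)

/-- The action of `H` on the kernel of `π` given by multiplication with `σ`. -/
def kernelAct : kernel π ⊗ H ⟶ kernel π :=
  kernel.lift π (kernel.ι π ⋆ σ) (by rw [extMul_comp, kernel.condition, zero_extMul])

lemma kernelAct_ι : kernelAct π σ ≫ kernel.ι π = kernel.ι π ⋆ σ :=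
  kernel.lift_ι _ _ _

lemma exists_comp_eq_extMul_id [SymmetricCategory C] [IsCommMonObj R] {W : C} (i : W ⟶ H) :
    ∃ l, l ≫ (kernel π ◁ i ≫ kernelAct π σ) ≫ kernel.ι π =
      ((kernel π ◁ i ≫ kernelAct π σ) ≫ kernel.ι π) ⋆ 𝟙 R := by
  refine ⟨(α_ _ _ _).hom ≫ kernel π ◁ (β_ _ _).hom ≫ (α_ _ _ _).inv ≫ kernelAct π (𝟙 R) ▷ W, ?_⟩
  have h : (kernel π ◁ i ≫ kernelAct π σ) ≫ kernel.ι π = kernel.ι π ⋆ (i ≫ σ) := by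
    rw [Category.assoc, kernelAct_ι, whiskerLeft_extMul]
  simp only [h, Category.assoc]
  rw [whiskerRight_extMul, kernelAct_ι, extMul_assoc, extMul_assoc, Iso.inv_hom_id_assoc,
    whiskerLeft_extMul, ← extMul_comm]

variable {π σ} [SymmetricCategory C] [MonObj H] [IsCommMonObj R] (hπ : IsSquareZero π)
  [IsMonHom (σ ≫ π)]

include hπ

lemma whiskerLeft_one_kernelAct : kernel π ◁ η[H] ≫ kernelAct π σ = (ρ_ _).hom := by
  have h : (η[H] ≫ σ) ≫ π = η[R] ≫ π := by
    rw [Category.assoc, IsMonHom.one_hom, IsMonHom.one_hom]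
  rw [← cancel_mono (kernel.ι π), Category.assoc, kernelAct_ι, whiskerLeft_extMul,
    hπ.extMul_congr (kernel.condition π) h, extMul_one]

lemma kernelAct_whiskerRight_kernelAct : kernelAct π σ ▷ H ≫ kernelAct π σ =
    (α_ _ _ _).hom ≫ kernel π ◁ μ[H] ≫ kernelAct π σ := by
  have h : (μ[H] ≫ σ) ≫ π = (σ ⋆ σ) ≫ π := by
    rw [Category.assoc, IsMonHom.mul_hom, extMul_comp, extMul]
  simp only [← cancel_mono (kernel.ι π), Category.assoc, kernelAct_ι]
  rw [whiskerRight_extMul, kernelAct_ι, whiskerLeft_extMul,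
    hπ.extMul_congr (kernel.condition π) h, extMul_assoc]

end Action

variable [SymmetricCategory C] [SplitEpiCategory C] {H : C} [HopfObj H] [IsCommMonObj H]
  {R S : ComodAlg H} {π : R.X ⟶ S.X} [IsMonHom π]

section

variable {σ : H ⟶ R.X} (hπ : IsSquareZero π) (hπ' : R.coact ≫ π ▷ H = π ≫ S.coact)
  (hσ : Δ[H] ≫ (σ ≫ π) ▷ H = (σ ≫ π) ≫ S.coact) {r : kernel π ⟶ kernel π ⊗ H}
  (hr : r ≫ kernel.ι π ▷ H = kernel.ι π ≫ R.coact)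

include hπ hπ' hσ hr in
lemma kernelAct_coact : kernelAct π σ ≫ r =
    (r ⊗ₘ Δ[H]) ≫ tensorμ _ H H H ≫ (kernelAct π σ ⊗ₘ μ[H]) := by
  have h₀ : (kernel.ι π ≫ R.coact) ≫ π ▷ H = 0 := by
    rw [Category.assoc, hπ', kernel.condition_assoc, zero_comp]
  have h : (σ ≫ R.coact) ≫ π ▷ H = (Δ[H] ≫ σ ▷ H) ≫ π ▷ H := by
    rw [Category.assoc, hπ', Category.assoc, ← comp_whiskerRight, hσ, Category.assoc]
  rw [← cancel_mono (kernel.ι π ▷ H)]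
  calc _ = (kernel.ι π ≫ R.coact) ⋆ (σ ≫ R.coact) := by
        rw [Category.assoc, hr, ← Category.assoc, kernelAct_ι, extMul_comp]
    _ = (r ≫ kernel.ι π ▷ H) ⋆ (Δ[H] ≫ σ ▷ H) := by
        rw [(hπ.whiskerRight H).extMul_congr h₀ h, hr]
    _ = (r ⊗ₘ Δ[H]) ≫ tensorμ _ H H H ≫ ((kernelAct π σ ≫ kernel.ι π) ⊗ₘ μ[H]) := by
        rw [← tensorHom_extMul, ← tensorHom_id, ← tensorHom_id, tensorHom_extMul_tensorHom,
          id_extMul_id, kernelAct_ι]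
    _ = _ := by
        rw [← tensorHom_id (kernel.ι π), Category.assoc, Category.assoc, tensorHom_comp_tensorHom,
          Category.comp_id]

/-- The kernel of a square zero extension `π : R ⟶ S` of comodule algebras, with its coaction `r`,
as a Hopf module: `S` acts on it, hence so does `H` through `σ ≫ π : H ⟶ S`. -/
def kernelHopfModule [IsMonHom (σ ≫ π)] : HopfModule H where
  toRightComod := RightComod.ofMono R.toRightComod (kernel.ι π) r hr
  act := kernelAct π σ
  act_one := whiskerLeft_one_kernelAct hπ
  act_mul := kernelAct_whiskerRight_kernelAct hπ
  act_coact := kernelAct_coact hπ hπ' hσ hr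

include hπ hπ' hσ hr in
lemma isIso_coact_comp_kernel_lift [IsMonHom (σ ≫ π)] {R' : C} {c : R.X ⟶ R'} [Epi c]
    {w : ((kernel π ◁ augIdeal.incl H ≫ kernelAct π σ) ≫ kernel.ι π) ≫ c = 0}
    (hc : (ShortComplex.mk _ c w).Exact) {π' : R' ⟶ S.X} (hcπ : c ≫ π' = π) :
    IsIso (r ≫ kernel.lift π' (kernel.ι π ≫ c) (by simp [hcπ]) ▷ H) := by
  obtain ⟨w', h⟩ := exact_kernel_lift_comp hcπ hc
  let M := kernelHopfModule hπ hπ' hσ hr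
  let cK : kernel π ⟶ kernel π' := kernel.lift π' (kernel.ι π ≫ c) (by simp [hcπ])
  have : Epi (X := M.X) cK := epi_kernel_lift_comp hcπ
  exact M.isIso_coact_comp cK w' h

end

/-- Lifting a colinear algebra morphism from `H` along `R ⟶ S` amounts to lifting the underlying
algebra morphism along the quotient `R' ⟶ S`, where `R' = R / I H⁺` with `I` the kernel of
`R ⟶ S`: by the fundamental theorem, `R` is the pullback of `S` and `R' ⊗ H`. -/
theorem exists_isComodAlgHom_regular_lift_of_isSquareZero [Mono (muHom H)] [Epi π]
    (hπ₀ : IsSquareZero π) (hπ : R.coact ≫ π ▷ H = π ≫ S.coact) {f : H ⟶ S.X}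
    (hf : IsComodAlgHom (ComodAlg.regular H) S f) :
    ∃ g : H ⟶ R.X, IsComodAlgHom (ComodAlg.regular H) R g ∧ g ≫ π = f := by
  obtain ⟨σ, rfl⟩ := exists_comp_eq_of_epi π f
  have : IsMonHom (σ ≫ π) := hf.isMonHom
  obtain ⟨r, hr⟩ := exists_kernel_coact (R := R.toRightComod) (S := S.toRightComod) π hπ
  let j := (kernel π ◁ augIdeal.incl H ≫ kernelAct π σ) ≫ kernel.ι π
  let c := cokernel.π j
  obtain ⟨_, _, (_ : IsMonHom c)⟩ :=
    exists_monObj_cokernel j (exists_comp_eq_extMul_id π σ (augIdeal.incl H))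
  let π' : cokernel j ⟶ S.X := cokernel.desc j π (by simp [j])
  have hcπ : c ≫ π' = π := cokernel.π_desc _ _ _
  have : IsMonHom π' := isMonHom_of_epi_comp c π' (by rwa [hcπ])
  have hσ' : σ ≫ π = (σ ≫ c) ≫ π' := by rw [Category.assoc, hcπ]
  have h_iso :=
    isIso_coact_comp_kernel_lift hπ₀ hπ hf.colinear hr (ShortComplex.exact_cokernel j) hcπ
  let cK : kernel π ⟶ kernel π' := kernel.lift π' (kernel.ι π ≫ c) (by simp [hcπ])
  have h_cK : cK ≫ kernel.ι π' = kernel.ι π ≫ c := kernel.lift_ι _ _ _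
  have : Epi cK := epi_kernel_lift_comp hcπ
  have hπ'₀ : IsSquareZero π' := by
    rw [IsSquareZero, ← cancel_epi (cK ⊗ₘ cK), tensorHom_extMul, h_cK, ← extMul_comp, hπ₀,
      zero_comp, comp_zero]
  have hσ'₀ : kernel.ι π' ⋆ (augIdeal.incl H ≫ σ ≫ c) = 0 := by
    rw [← cancel_epi (cK ▷ _), whiskerRight_extMul, h_cK, ← Category.assoc (augIdeal.incl H),
      ← extMul_comp, comp_zero, ← whiskerLeft_extMul, ← kernelAct_ι]
    simpa [j] using cokernel.condition j
  have : IsMonHom ((σ ≫ c) ≫ π') := by rwa [← hσ']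
  obtain ⟨g', hg', hg'σ⟩ := exists_isMonHom_lift_of_kernel hπ'₀ hσ'₀
  exact ComodAlg.exists_lift_of_isPullback ⟨inferInstance, hπ⟩
    (isPullback_of_isIso_kernel hπ hr hcπ) hf hg' (hg'σ.trans hσ'.symm)

end KernelHopfModule

section NilpotentLifting

variable {C : Type u} [Category.{v} C] [MonoidalCategory C]

section

variable {I J R : C} [MonObj R]

lemma mulPow_succ (i : I ⟶ R) (n : ℕ) : mulPow i (n + 1) = mulPow i n ⋆ i := rfl

lemma mulPow_one (i : I ⟶ R) : mulPow i 1 = (λ_ I).hom ≫ i := one_extMul i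

lemma mulPow_comp {S : C} [MonObj S] (i : I ⟶ R) (φ : R ⟶ S) [IsMonHom φ] (n : ℕ) :
    mulPow i n ≫ φ = mulPow (i ≫ φ) n := by
  induction n with
  | zero => exact IsMonHom.one_hom φ
  | succ n ih =>
    rw [mulPow_succ, mulPow_succ, ← ih]
    exact extMul_comp _ _ _

lemma exists_comp_mulPow_eq (l : J ⟶ I) (i : I ⟶ R) (n : ℕ) :
    ∃ t, t ≫ mulPow i n = mulPow (l ≫ i) n := by
  induction n with
  | zero => exact ⟨𝟙 _, Category.id_comp _⟩
  | succ n ih =>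
    obtain ⟨t, ht⟩ := ih
    exact ⟨t ⊗ₘ l, (tensorHom_extMul _ _ _ _).trans (by rw [ht, mulPow_succ])⟩

lemma exists_comp_mulPow_whiskerRight_eq [BraidedCategory C] (i : I ⟶ R) (U : C) [MonObj U]
    (n : ℕ) : ∃ t, t ≫ mulPow i n ▷ U = mulPow (i ▷ U) n := by
  induction n with
  | zero =>
    have h : ((λ_ (𝟙_ C)).inv ≫ 𝟙_ C ◁ η[U]) ≫ η[R] ▷ U = η[R ⊗ U] := by
      rw [MonObj.tensorObj.one_def, tensorHom_def', Category.assoc]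
    exact ⟨_, h⟩
  | succ n ih =>
    obtain ⟨t, ht⟩ := ih
    have h : (t ▷ (I ⊗ U) ≫ tensorμ _ _ _ _ ≫ _ ◁ μ[U]) ≫ (mulPow i n ⋆ i) ▷ U =
        (t ≫ mulPow i n ▷ U) ⋆ (i ▷ U) := by
      rw [← whiskerRight_extMul, ← tensorHom_id (mulPow i n), ← tensorHom_id i,
        tensorHom_extMul_tensorHom, id_extMul_id, tensorHom_def']
      simp only [Category.assoc]
    exact ⟨_, h.trans (by rw [ht, mulPow_succ])⟩

lemma exists_comp_extMul_kernel_eq [Preadditive C] [HasKernels C] [MonoidalPreadditive C] {S : C}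
    [MonObj S] (π : R ⟶ S) [IsMonHom π] (x : I ⟶ R) :
    ∃ t, t ≫ (x ⋆ kernel.ι π) = (x ⋆ kernel.ι π) ⋆ 𝟙 R := by
  have h : (kernel.ι π ⋆ 𝟙 R) ≫ π = 0 := by rw [extMul_comp, kernel.condition, zero_extMul]
  refine ⟨(α_ _ _ _).hom ≫ _ ◁ kernel.lift π _ h, ?_⟩
  rw [Category.assoc, whiskerLeft_extMul, kernel.lift_ι, extMul_assoc]

end

variable [Abelian C] [SplitEpiCategory C]

lemma exists_comp_mulPow_kernel_whiskerRight_eq [MonoidalPreadditive C] [BraidedCategory C]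
    {Q : C} [BimonObj Q] {R S : ComodAlg Q} {π : R.X ⟶ S.X} (hπ : IsComodAlgHom R S π) (n : ℕ) :
    ∃ t, t ≫ mulPow (kernel.ι π) n ▷ Q = mulPow (kernel.ι π) n ≫ R.coact := by
  obtain ⟨r, hr⟩ := exists_kernel_coact (R := R.toRightComod) (S := S.toRightComod) π hπ.colinear
  obtain ⟨t, ht⟩ := exists_comp_mulPow_whiskerRight_eq (kernel.ι π) Q n
  obtain ⟨t', ht'⟩ := exists_comp_mulPow_eq r (kernel.ι π ▷ Q) n
  exact ⟨t' ≫ t, by rw [Category.assoc, ht, ht', hr, ← mulPow_comp]⟩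

lemma mulPow_kernel_ι_eq_zero_of_comp {R R' S : C} [MonObj R] [MonObj R'] {c : R ⟶ R'} [Epi c]
    [IsMonHom c] {π : R ⟶ S} {π' : R' ⟶ S} (hcπ : c ≫ π' = π) {n : ℕ}
    (h : mulPow (kernel.ι π) n ≫ c = 0) : mulPow (kernel.ι π') n = 0 := by
  obtain ⟨x, hx⟩ := exists_comp_eq_of_epi c (kernel.ι π')
  have h_ι : kernel.ι π' = kernel.lift π x (by rw [← hcπ, reassoc_of% hx, kernel.condition]) ≫
      kernel.ι π ≫ c := by
    rw [kernel.lift_ι_assoc, hx]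
  obtain ⟨t, ht⟩ := exists_comp_mulPow_eq (kernel.lift π x _) (kernel.ι π ≫ c) n
  rw [h_ι, ← ht, ← mulPow_comp, h, comp_zero]

lemma isSquareZero_of_exact {R R' S J : C} [MonObj R] {π : R ⟶ S} {c : R ⟶ R'} {π' : R' ⟶ S}
    (hcπ : c ≫ π' = π) {j : J ⟶ R} {w : j ≫ c = 0} (h : (ShortComplex.mk j c w).Exact)
    (hj : j ⋆ kernel.ι π = 0) : IsSquareZero c := by
  obtain ⟨l, hl⟩ : ∃ l, l ≫ j = kernel.ι c :=
    ⟨_, h.liftFromProjective_comp (kernel.ι c) (kernel.condition c)⟩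
  have h_ι : kernel.lift π (kernel.ι c) (by rw [← hcπ, kernel.condition_assoc, zero_comp]) ≫
      kernel.ι π = kernel.ι c := kernel.lift_ι _ _ _
  calc kernel.ι c ⋆ kernel.ι c = (l ≫ j) ⋆ (kernel.lift π (kernel.ι c) _ ≫ kernel.ι π) := by
        rw [hl, h_ι]
    _ = 0 := by rw [← tensorHom_extMul, hj, comp_zero]

variable [MonoidalPreadditive C] [SymmetricCategory C] {Q : C} [BimonObj Q]

theorem ComodAlg.isSmooth_of_isSquareZero (A : ComodAlg Q)
    (h_lift : ∀ {R S : ComodAlg Q} (π : R.X ⟶ S.X) [Epi π], IsComodAlgHom R S π →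
      IsSquareZero π → ∀ f : A.X ⟶ S.X, IsComodAlgHom A S f →
      ∃ g : A.X ⟶ R.X, IsComodAlgHom A R g ∧ g ≫ π = f) : A.IsSmooth := by
  rintro R S π _ hπ ⟨n, hn⟩
  replace hn : mulPow (kernel.ι π) (n + 1) = 0 := by
    rw [mulPow_succ, hn]
    exact zero_extMul _
  induction n generalizing R with
  | zero =>
    have h_ι : kernel.ι π = 0 := by
      rw [← cancel_epi (λ_ (kernel π)).hom, comp_zero]
      exact (mulPow_one _).symm.trans hn
    exact h_lift π hπ (by rw [IsSquareZero, h_ι, zero_extMul])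
  | succ n ih =>
    have := hπ.isMonHom
    obtain ⟨R', c, w, _, hc, h_exact⟩ := R.exists_quotient (mulPow (kernel.ι π) (n + 1))
      (exists_comp_extMul_kernel_eq π (mulPow _ n))
      (exists_comp_mulPow_kernel_whiskerRight_eq hπ _)
    have := hc.isMonHom
    obtain ⟨π', hcπ⟩ : ∃ π', c ≫ π' = π :=
      have h_mulPow : (mulPow (kernel.ι π) n ⋆ kernel.ι π) ≫ π = 0 := by
        rw [extMul_comp, kernel.condition, extMul_zero]
      ⟨h_exact.desc π h_mulPow, h_exact.g_desc _ _⟩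
    have : Epi π' := epi_of_epi_fac hcπ
    intro f hf
    obtain ⟨g', hg', hgf'⟩ := ih R' π' (hc.of_epi_comp (by rwa [hcπ]))
      (mulPow_kernel_ι_eq_zero_of_comp hcπ w) f hf
    obtain ⟨g, hg, hgc⟩ := h_lift c hc (isSquareZero_of_exact hcπ h_exact hn) g' hg'
    exact ⟨g, hg, by rw [← hcπ, reassoc_of% hgc, hgf']⟩

theorem regular_isSmooth_of_mono_muHom (H : C) [HopfObj H] [IsCommMonObj H] [Mono (muHom H)] :
    (ComodAlg.regular H).IsSmooth :=
  (ComodAlg.regular H).isSmooth_of_isSquareZero fun _ _ hπ hπ₀ _ hf =>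
    have := hπ.isMonHom
    exists_isComodAlgHom_regular_lift_of_isSquareZero hπ₀ hπ.colinear hf

end NilpotentLifting

section Cotensor

open scoped HopfObj

variable {C : Type u} [Category.{v} C] [MonoidalCategory C]

section Functoriality

variable [HasEqualizers C] {Q : C} [ComonObj Q]

instance (V : RightComod Q) (W : LeftComod Q) : Mono (cotensorι V W) :=
  ⟨fun _ _ h => cotensor_hom_ext h⟩

section

variable {X : C} {V : RightComod Q} {W : LeftComod Q} (x : X ⟶ V.X ⊗ W.X)
  (hx : x ≫ V.coact ▷ W.X = x ≫ V.X ◁ W.coact ≫ (α_ V.X Q W.X).inv)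

/-- The universal property of `V □_Q W`. -/
def cotensorLift : X ⟶ cotensorObj V W := equalizer.lift x hx

lemma cotensorLift_ι : cotensorLift x hx ≫ cotensorι V W = x := equalizer.lift_ι x hx

end

/-- The morphism `V □_Q W ⟶ V' □_Q W` induced by a colinear morphism `V ⟶ V'`. -/
def cotensorMapLeft {V V' : RightComod Q} (g : V.X ⟶ V'.X)
    (hg : V.coact ≫ g ▷ Q = g ≫ V'.coact) (W : LeftComod Q) :
    cotensorObj V W ⟶ cotensorObj V' W :=
  cotensorLift (cotensorι V W ≫ g ▷ W.X) (by
    rw [Category.assoc, ← comp_whiskerRight, ← hg, comp_whiskerRight,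
      reassoc_of% cotensorι_condition V W, Category.assoc, ← whisker_exchange_assoc,
      associator_inv_naturality_left])

lemma cotensorMapLeft_ι {V V' : RightComod Q} (g : V.X ⟶ V'.X)
    (hg : V.coact ≫ g ▷ Q = g ≫ V'.coact) (W : LeftComod Q) :
    cotensorMapLeft g hg W ≫ cotensorι V' W = cotensorι V W ≫ g ▷ W.X :=
  cotensorLift_ι _ _

end Functoriality

section Flip

variable [BraidedCategory C]

instance (H : C) [HopfObj H] [IsCommMonObj H] : IsIso 𝒮[H] :=
  have h := HopfObj.antipode_antipode H (IsCommMonObj.mul_comm H)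
  ⟨𝒮[H], h, h⟩

lemma associator_braiding_braiding_tensor (X Y Z : C) :
    (α_ X Y Z).hom ≫ X ◁ (β_ Y Z).hom ≫ (β_ X (Z ⊗ Y)).hom ≫ (α_ Z Y X).hom =
      (β_ X Y).hom ▷ Z ≫ (β_ (Y ⊗ X) Z).hom := by
  rw [BraidedCategory.braiding_naturality_right_assoc]
  simp [BraidedCategory.braiding_tensor_left_hom, BraidedCategory.braiding_tensor_right_hom]

variable {Q : C} [HopfObj Q]

/-- The left coaction `v ↦ 𝒮(v₁) ⊗ v₀` on a right comodule. -/
def RightComod.flipCoact (V : RightComod Q) : V.X ⟶ Q ⊗ V.X :=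
  V.coact ≫ V.X ◁ 𝒮[Q] ≫ (β_ V.X Q).hom

/-- A right comodule as a left comodule, by means of the antipode. -/
abbrev RightComod.flip (V : RightComod Q) : LeftComod Q where
  X := V.X
  coact := V.flipCoact
  coact_counit := by
    rw [flipCoact, Category.assoc, Category.assoc, ← BraidedCategory.braiding_naturality_right,
      ← MonoidalCategory.whiskerLeft_comp_assoc, HopfObj.antipode_counit,
      reassoc_of% V.coact_counit]
    simp
  coact_comul := by
    have h_coact : (β_ V.X Q).hom ≫ Q ◁ V.flipCoact =
        (V.coact ▷ Q ≫ (V.X ◁ 𝒮[Q]) ▷ Q ≫ (β_ V.X Q).hom ▷ Q) ≫ (β_ (Q ⊗ V.X) Q).hom := by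
      rw [← BraidedCategory.braiding_naturality_left]
      simp only [flipCoact, comp_whiskerRight]
    nth_rw 1 [flipCoact]
    nth_rw 2 [flipCoact]
    simp only [Category.assoc]
    rw [← BraidedCategory.braiding_naturality_right_assoc,
      ← MonoidalCategory.whiskerLeft_comp_assoc, HopfObj.antipode_comul,
      MonoidalCategory.whiskerLeft_comp_assoc, reassoc_of% V.coact_comul,
      ← BraidedCategory.braiding_naturality, MonoidalCategory.whiskerLeft_comp_assoc, h_coact]
    simp only [Category.assoc]
    rw [← associator_braiding_braiding_tensor, whisker_exchange_assoc]
    simp [MonoidalCategory.tensorHom_def']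

/-- A colinear morphism of right comodules, as a morphism of the corresponding left comodules. -/
def RightComod.flipHom {V V' : RightComod Q} (g : V.X ⟶ V'.X)
    (hg : V.coact ≫ g ▷ Q = g ≫ V'.coact) : V.flip ⟶ V'.flip :=
  ⟨g, show V.flipCoact ≫ Q ◁ g = g ≫ V'.flipCoact by
    rw [flipCoact, flipCoact, ← reassoc_of% hg, Category.assoc, Category.assoc,
      ← BraidedCategory.braiding_naturality_left, whisker_exchange_assoc]⟩

section

variable (V : RightComod Q) {W : LeftComod Q} {U : RightComod Q} (σ : W.X ⟶ U.X)

/-- The morphism `v ⊗ w ↦ σ(w) ⊗ v`. -/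
def tensorFlip : V.X ⊗ W.X ⟶ U.X ⊗ V.X := V.X ◁ σ ≫ (β_ V.X U.X).hom

/-- The morphism `v ⊗ x ⊗ w ↦ σ(w) ⊗ 𝒮(x) ⊗ v`. -/
def tensorFlip₂ : (V.X ⊗ Q) ⊗ W.X ⟶ (U.X ⊗ Q) ⊗ V.X :=
  (α_ V.X Q W.X).hom ≫ V.X ◁ ((β_ Q W.X).hom ≫ (σ ⊗ₘ 𝒮[Q])) ≫ (β_ V.X (U.X ⊗ Q)).hom

lemma coact_tensorFlip₂ : V.coact ▷ W.X ≫ tensorFlip₂ V σ =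
    tensorFlip V σ ≫ U.X ◁ V.flipCoact ≫ (α_ U.X Q V.X).inv := by
  have h_coact : V.X ◁ σ ≫ (β_ V.X U.X).hom ≫ U.X ◁ V.flipCoact =
      V.X ◁ σ ≫ V.coact ▷ U.X ≫ (V.X ◁ 𝒮[Q]) ▷ U.X ≫ (β_ V.X Q).hom ▷ U.X ≫
        (β_ (Q ⊗ V.X) U.X).hom := by
    rw [← BraidedCategory.braiding_naturality_left]
    simp only [RightComod.flipCoact, comp_whiskerRight, Category.assoc]
  rw [tensorFlip, Category.assoc, reassoc_of% h_coact,
    ← reassoc_of% associator_braiding_braiding_tensor V.X Q U.X, tensorFlip₂,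
    ← BraidedCategory.braiding_naturality, whisker_exchange_assoc,
    MonoidalCategory.tensorHom_def']
  simp only [MonoidalCategory.whiskerLeft_comp, Category.assoc]
  simp

lemma coact_tensorFlip₂' (hσ : W.coact ≫ (β_ Q W.X).hom ≫ (σ ⊗ₘ 𝒮[Q]) = σ ≫ U.coact) :
    (V.X ◁ W.coact ≫ (α_ V.X Q W.X).inv) ≫ tensorFlip₂ V σ =
      tensorFlip V σ ≫ U.coact ▷ V.X := by
  rw [tensorFlip₂, Category.assoc, Iso.inv_hom_id_assoc, ← MonoidalCategory.whiskerLeft_comp_assoc,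
    hσ, tensorFlip, Category.assoc, ← BraidedCategory.braiding_naturality_right,
    MonoidalCategory.whiskerLeft_comp_assoc]

lemma tensorFlip_naturality {V V' : RightComod Q} (g : V.X ⟶ V'.X) :
    tensorFlip V σ ≫ U.X ◁ g = g ▷ W.X ≫ tensorFlip V' σ := by
  rw [tensorFlip, tensorFlip, Category.assoc, ← BraidedCategory.braiding_naturality_left,
    whisker_exchange_assoc]

variable [IsIso σ]

instance : IsIso (tensorFlip V σ) := by
  unfold tensorFlip
  infer_instance

instance [IsCommMonObj Q] : IsIso (tensorFlip₂ V σ) := by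
  unfold tensorFlip₂
  infer_instance

variable [IsCommMonObj Q] [HasEqualizers C]
  (hσ : W.coact ≫ (β_ Q W.X).hom ≫ (σ ⊗ₘ 𝒮[Q]) = σ ≫ U.coact)
include hσ

lemma exists_cotensorObj_iso : ∃ φ : cotensorObj V W ≅ cotensorObj U V.flip,
    φ.hom ≫ cotensorι U V.flip = cotensorι V W ≫ tensorFlip V σ := by
  have h_hom : (cotensorι V W ≫ tensorFlip V σ) ≫ U.coact ▷ V.X =
      (cotensorι V W ≫ tensorFlip V σ) ≫ U.X ◁ V.flipCoact ≫ (α_ U.X Q V.X).inv := by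
    rw [Category.assoc, Category.assoc, ← coact_tensorFlip₂, ← coact_tensorFlip₂' V σ hσ,
      reassoc_of% cotensorι_condition V W, Category.assoc]
  have h_inv : (cotensorι U V.flip ≫ inv (tensorFlip V σ)) ≫ V.coact ▷ W.X =
      (cotensorι U V.flip ≫ inv (tensorFlip V σ)) ≫ V.X ◁ W.coact ≫ (α_ V.X Q W.X).inv := by
    rw [← cancel_mono (tensorFlip₂ V σ)]
    have h := (cotensorι_condition U V.flip).symm
    dsimp only at h
    rw [Category.assoc, Category.assoc, Category.assoc, Category.assoc, coact_tensorFlip₂,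
      coact_tensorFlip₂' V σ hσ, IsIso.inv_hom_id_assoc, IsIso.inv_hom_id_assoc, h]
  refine ⟨⟨cotensorLift _ h_hom, cotensorLift _ h_inv, cotensor_hom_ext ?_,
    cotensor_hom_ext ?_⟩, cotensorLift_ι _ _⟩
  · rw [Category.assoc, cotensorLift_ι, ← Category.assoc, cotensorLift_ι, Category.assoc,
      IsIso.hom_inv_id, Category.comp_id, Category.id_comp]
  · rw [Category.assoc, cotensorLift_ι, ← Category.assoc, cotensorLift_ι, Category.assoc,
      IsIso.inv_hom_id, Category.comp_id, Category.id_comp]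

end

section Epi

variable [Abelian C] [SplitEpiCategory C] [MonoidalPreadditive C]

lemma IsCoflat.epi_cotensorMap {U : RightComod Q} (hU : IsCoflat U) {V V' : RightComod Q}
    (g : V.X ⟶ V'.X) (hg : V.coact ≫ g ▷ Q = g ≫ V'.coact) [Epi g] :
    Epi (cotensorMap U (RightComod.flipHom g hg)) := by
  obtain ⟨r, hr⟩ := exists_kernel_coact g hg
  obtain ⟨_, h_exact⟩ := hU _ _ _ (RightComod.flipHom (V := V.ofMono (kernel.ι g) r hr) _ hr)
    (RightComod.flipHom g hg) (kernel.condition g)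
    { exact := ShortComplex.exact_kernel g
      mono_f := inferInstanceAs (Mono (kernel.ι g))
      epi_g := inferInstanceAs (Epi g) }
  exact h_exact.epi_g

lemma IsCoflat.epi_cotensorMapLeft [IsCommMonObj Q] {U : RightComod Q} (hU : IsCoflat U)
    {W : LeftComod Q} (σ : W.X ⟶ U.X) [IsIso σ]
    (hσ : W.coact ≫ (β_ Q W.X).hom ≫ (σ ⊗ₘ 𝒮[Q]) = σ ≫ U.coact) {V V' : RightComod Q}
    (g : V.X ⟶ V'.X) (hg : V.coact ≫ g ▷ Q = g ≫ V'.coact) [Epi g] :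
    Epi (cotensorMapLeft g hg W) := by
  obtain ⟨φ, hφ⟩ := exists_cotensorObj_iso V σ hσ
  obtain ⟨φ', hφ'⟩ := exists_cotensorObj_iso V' σ hσ
  have h_map : cotensorMapLeft g hg W ≫ φ'.hom =
      φ.hom ≫ cotensorMap U (RightComod.flipHom g hg) := by
    apply cotensor_hom_ext
    rw [Category.assoc, hφ', ← Category.assoc, cotensorMapLeft_ι, Category.assoc, Category.assoc,
      cotensorMap_ι, reassoc_of% hφ, ← tensorFlip_naturality]
    rfl
  have := hU.epi_cotensorMap g hg
  rw [← Iso.eq_comp_inv] at h_map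
  rw [h_map]
  infer_instance

end Epi

end Flip

end Cotensor

section Subalgebra

variable {C : Type u} [Category.{v} C] [MonoidalCategory C]

lemma isMonHom_of_comp_mono {A R S : C} [MonObj A] [MonObj R] [MonObj S] (x : A ⟶ R) (e : R ⟶ S)
    [Mono e] [IsMonHom e] (h : IsMonHom (x ≫ e)) : IsMonHom x where
  one_hom := by rw [← cancel_mono e, Category.assoc, IsMonHom.one_hom, IsMonHom.one_hom]
  mul_hom := by
    rw [← cancel_mono e, Category.assoc, IsMonHom.mul_hom, Category.assoc, IsMonHom.mul_hom,
      tensorHom_comp_tensorHom_assoc]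

section Transport

variable {R T : C} [MonObj R] (e : T ⟶ R) [Mono e] (o : 𝟙_ C ⟶ T) (ho : o ≫ e = η[R])
  (m : T ⊗ T ⟶ T) (hm : m ≫ e = e ⋆ e)

/-- The algebra structure on the subobject `e` of an algebra, with unit `o` and product `m`. -/
@[reducible]
def monObjOfMono : MonObj T where
  one := o
  mul := m
  one_mul := by
    rw [← cancel_mono e, Category.assoc, hm, whiskerRight_extMul, ho, one_extMul]
  mul_one := by
    rw [← cancel_mono e, Category.assoc, hm, whiskerLeft_extMul, ho, extMul_one]
  mul_assoc := by
    rw [← cancel_mono e]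
    simp only [Category.assoc]
    rw [hm, whiskerRight_extMul, whiskerLeft_extMul, hm, extMul_assoc]

lemma isMonHom_monObjOfMono :
    letI := monObjOfMono e o ho m hm
    IsMonHom e :=
  let _ := monObjOfMono e o ho m hm
  { one_hom := ho
    mul_hom := hm }

end Transport

lemma isCommMonObj_of_mono [BraidedCategory C] {R T : C} [MonObj R] [IsCommMonObj R] [MonObj T]
    (e : T ⟶ R) [Mono e] [IsMonHom e] : IsCommMonObj T where
  mul_comm := by
    rw [← cancel_mono e, Category.assoc, IsMonHom.mul_hom,
      ← BraidedCategory.braiding_naturality_assoc, IsCommMonObj.mul_comm]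

variable [BraidedCategory C] [Abelian C] [SplitEpiCategory C] [MonoidalPreadditive C] {Q : C}
  [BimonObj Q]

/-- The subalgebra `e` of a comodule algebra, with the restricted coaction `r`. -/
abbrev ComodAlg.ofMono (R : ComodAlg Q) {T : C} [MonObj T] (e : T ⟶ R.X) [Mono e] [IsMonHom e]
    (r : T ⟶ T ⊗ Q) (hr : r ≫ e ▷ Q = e ≫ R.coact) : ComodAlg Q where
  X := T
  coact := r
  coact_counit := (R.toRightComod.ofMono e r hr).coact_counit
  coact_comul := (R.toRightComod.ofMono e r hr).coact_comul
  comm := isCommMonObj_of_mono e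
  isMonHom_coact := isMonHom_of_comp_mono r (e ▷ Q) (by rw [hr]; infer_instance)

lemma IsComodAlgHom.of_comp_mono {A R S : ComodAlg Q} {x : A.X ⟶ R.X} {e : R.X ⟶ S.X} [Mono e]
    (he : IsComodAlgHom R S e) (hxe : IsComodAlgHom A S (x ≫ e)) : IsComodAlgHom A R x where
  isMonHom := have := he.isMonHom; isMonHom_of_comp_mono x e hxe.isMonHom
  colinear := by
    rw [← cancel_mono (e ▷ Q), Category.assoc, Category.assoc, he.colinear, ← comp_whiskerRight,
      hxe.colinear, Category.assoc]

end Subalgebra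

section ComoduleAlgebraConstructions

variable {C : Type u} [Category.{v} C] [MonoidalCategory C]

lemma IsComodAlgHom.comp [BraidedCategory C] {Q : C} [BimonObj Q] {A B D : ComodAlg Q}
    {f : A.X ⟶ B.X} {g : B.X ⟶ D.X} (hf : IsComodAlgHom A B f) (hg : IsComodAlgHom B D g) :
    IsComodAlgHom A D (f ≫ g) where
  isMonHom := have := hf.isMonHom; have := hg.isMonHom; inferInstance
  colinear := by
    rw [comp_whiskerRight, reassoc_of% hf.colinear, hg.colinear, Category.assoc]

section Restrict

variable [BraidedCategory C] {H Q : C} [BimonObj H] [BimonObj Q] (q : H ⟶ Q) [IsBimonHom q]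

/-- The coaction of `Q` on an `H`-comodule algebra through `q : H ⟶ Q`. -/
abbrev ComodAlg.restrict (A : ComodAlg H) : ComodAlg Q where
  X := A.X
  coact := A.coact ≫ A.X ◁ q
  coact_counit := by
    rw [Category.assoc, ← MonoidalCategory.whiskerLeft_comp, IsComonHom.hom_counit,
      A.coact_counit]
  coact_comul := by
    rw [Category.assoc, ← MonoidalCategory.whiskerLeft_comp, IsComonHom.hom_comul,
      MonoidalCategory.whiskerLeft_comp, reassoc_of% A.coact_comul]
    simp only [Category.assoc, comp_whiskerRight, whisker_exchange_assoc]
    simp [MonoidalCategory.tensorHom_def]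
  isMonHom_coact := inferInstance

lemma IsComodAlgHom.restrict {A B : ComodAlg H} {f : A.X ⟶ B.X} (hf : IsComodAlgHom A B f) :
    IsComodAlgHom (A.restrict q) (B.restrict q) f where
  isMonHom := hf.isMonHom
  colinear := by
    rw [Category.assoc, whisker_exchange, reassoc_of% hf.colinear]

end Restrict

/-- The cofree comodule algebra `R ⊗ H`. -/
abbrev ComodAlg.cofree [SymmetricCategory C] (R H : C) [MonObj R] [IsCommMonObj R] [BimonObj H]
    [IsCommMonObj H] : ComodAlg H where
  X := R ⊗ H
  coact := R ◁ Δ[H] ≫ (α_ R H H).inv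
  coact_counit := by
    rw [Category.assoc, ← associator_inv_naturality_right,
      ← MonoidalCategory.whiskerLeft_comp_assoc, ComonObj.comul_counit]
    monoidal
  coact_comul := by
    have h := congrArg (R ◁ ·) (ComonObj.comul_assoc H)
    simp only [MonoidalCategory.whiskerLeft_comp] at h
    rw [Category.assoc, ← associator_inv_naturality_right, reassoc_of% h]
    simp
  isMonHom_coact := inferInstance

section LeftCoaction

variable {H Q : C} [ComonObj H] (q : H ⟶ Q)

/-- The coaction `h ↦ q(h₁) ⊗ h₂` of `Q` on `H`. -/
def leftCoact : H ⟶ Q ⊗ H := Δ[H] ≫ q ▷ H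

lemma leftCoact_comul : leftCoact q ≫ Q ◁ Δ[H] = Δ[H] ≫ leftCoact q ▷ H ≫ (α_ Q H H).hom := by
  rw [leftCoact, Category.assoc, ← whisker_exchange, ComonObj.comul_assoc_assoc]
  simp

lemma leftCoact_counit : leftCoact q ≫ Q ◁ ε[H] = q ≫ (ρ_ Q).inv := by
  rw [leftCoact, Category.assoc, ← whisker_exchange, ComonObj.comul_counit_assoc,
    rightUnitor_inv_naturality]

variable [ComonObj Q] [IsComonHom q] in
/-- `H` as a left `Q`-comodule through `q : H ⟶ Q`. -/
abbrev LeftComod.ofHom : LeftComod Q where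
  X := H
  coact := leftCoact q
  coact_counit := by
    rw [leftCoact, Category.assoc, ← comp_whiskerRight, IsComonHom.hom_counit,
      ComonObj.counit_comul]
  coact_comul := by
    calc leftCoact q ≫ Q ◁ leftCoact q
        = (leftCoact q ≫ Q ◁ Δ[H]) ≫ Q ◁ q ▷ H := by
          rw [Category.assoc, ← MonoidalCategory.whiskerLeft_comp, leftCoact]
      _ = Δ[H] ≫ (Δ[H] ≫ (q ⊗ₘ q)) ▷ H ≫ (α_ Q Q H).hom := by
          rw [leftCoact_comul, leftCoact]
          simp [MonoidalCategory.tensorHom_def]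
      _ = leftCoact q ≫ Δ[Q] ▷ H ≫ (α_ Q Q H).hom := by
          rw [← IsComonHom.hom_comul, leftCoact, comp_whiskerRight, Category.assoc, Category.assoc]

instance [BraidedCategory C] {H Q : C} [BimonObj H] [MonObj Q] (q : H ⟶ Q) [IsMonHom q] :
    IsMonHom (leftCoact q) := by
  unfold leftCoact
  infer_instance

end LeftCoaction

end ComoduleAlgebraConstructions

section Induction

variable {C : Type u} [Category.{v} C] [MonoidalCategory C] {H Q : C}

section Inclusion

variable [HasEqualizers C] [ComonObj H] [ComonObj Q] (q : H ⟶ Q) [IsComonHom q]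
  (R : RightComod Q)

/-- The inclusion `R □_Q H ⟶ R ⊗ H`. -/
def induceι : cotensorObj R (LeftComod.ofHom q) ⟶ R.X ⊗ H := cotensorι R (LeftComod.ofHom q)

instance : Mono (induceι q R) := inferInstanceAs (Mono (cotensorι _ _))

lemma induceι_condition : induceι q R ≫ R.coact ▷ H =
    induceι q R ≫ R.X ◁ leftCoact q ≫ (α_ R.X Q H).inv :=
  cotensorι_condition R (LeftComod.ofHom q)

variable {R} in
/-- The universal property of `R □_Q H`. -/
def induceLift {X : C} (x : X ⟶ R.X ⊗ H)
    (hx : x ≫ R.coact ▷ H = x ≫ R.X ◁ leftCoact q ≫ (α_ R.X Q H).inv) :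
    X ⟶ cotensorObj R (LeftComod.ofHom q) :=
  cotensorLift x hx

variable {R} in
lemma induceLift_ι {X : C} (x : X ⟶ R.X ⊗ H)
    (hx : x ≫ R.coact ▷ H = x ≫ R.X ◁ leftCoact q ≫ (α_ R.X Q H).inv) :
    induceLift q x hx ≫ induceι q R = x :=
  cotensorLift_ι _ _

lemma exists_induce_coact [Abelian C] [SplitEpiCategory C]
    [MonoidalPreadditive C] :
    ∃ r : cotensorObj R (LeftComod.ofHom q) ⟶ cotensorObj R (LeftComod.ofHom q) ⊗ H,
      r ≫ induceι q R ▷ H = induceι q R ≫ R.X ◁ Δ[H] ≫ (α_ R.X H H).inv := by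
  have h_comul : R.X ◁ Δ[H] ≫ (α_ R.X H H).inv ≫ (R.X ◁ leftCoact q ≫ (α_ R.X Q H).inv) ▷ H =
      R.X ◁ leftCoact q ≫ (α_ R.X Q H).inv ≫ (R.X ⊗ Q) ◁ Δ[H] ≫ (α_ _ _ _).inv := by
    have h := congrArg (R.X ◁ ·) (leftCoact_comul q)
    simp only [MonoidalCategory.whiskerLeft_comp] at h
    rw [← associator_inv_naturality_right_assoc, reassoc_of% h]
    simp
  refine exists_comp_equalizer_whiskerRight H (R.coact ▷ H)
    (R.X ◁ leftCoact q ≫ (α_ R.X Q H).inv) _ ?_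
  simp only [Category.assoc]
  rw [h_comul, ← reassoc_of% induceι_condition q R, ← associator_inv_naturality_left,
    whisker_exchange_assoc]

end Inclusion

section InducedAlgebra

variable [SymmetricCategory C] [Abelian C]

section

variable [BimonObj H] [BimonObj Q] (q : H ⟶ Q) [IsBimonHom q] (R : ComodAlg Q)

instance : MonObj (cotensorObj R.toRightComod (LeftComod.ofHom q)) :=
  monObjOfMono (induceι q R.toRightComod)
    (induceLift q η (by rw [IsMonHom.one_hom, IsMonHom.one_hom])) (induceLift_ι _ _ _)
    (induceLift q (induceι q R.toRightComod ⋆ induceι q R.toRightComod)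
      (by rw [extMul_comp, extMul_comp, induceι_condition])) (induceLift_ι _ _ _)

instance : IsMonHom (induceι q R.toRightComod) :=
  isMonHom_monObjOfMono _ _ (induceLift_ι _ _ _) _ (induceLift_ι _ _ _)

end

variable [SplitEpiCategory C] [MonoidalPreadditive C] [BimonObj H] [IsCommMonObj H] [BimonObj Q]
  (q : H ⟶ Q) [IsBimonHom q]

/-- The comodule algebra `R □_Q H` over `H`. -/
abbrev ComodAlg.induce (R : ComodAlg Q) : ComodAlg H :=
  (ComodAlg.cofree R.X H).ofMono (induceι q R.toRightComod)
    (exists_induce_coact q R.toRightComod).choose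
    (exists_induce_coact q R.toRightComod).choose_spec

lemma isComodAlgHom_induceι (R : ComodAlg Q) :
    IsComodAlgHom (R.induce q) (ComodAlg.cofree R.X H) (induceι q R.toRightComod) where
  isMonHom := inferInstance
  colinear := (exists_induce_coact q R.toRightComod).choose_spec

instance isMonHom_counit (H : C) [BimonObj H] : IsMonHom ε[H] where
  one_hom := by simp
  mul_hom := by rw [Bimon.mul_counit]; rfl

section Adjunction

variable {q} {A : ComodAlg H} {R S : ComodAlg Q}

lemma exists_isComodAlgHom_induce {f : A.X ⟶ R.X} (hf : IsComodAlgHom (A.restrict q) R f) :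
    ∃ F : A.X ⟶ (R.induce q).X, IsComodAlgHom A (R.induce q) F ∧
      F ≫ induceι q R.toRightComod = A.coact ≫ f ▷ H := by
  have := hf.isMonHom
  have h_colinear : (A.coact ≫ A.X ◁ q) ≫ f ▷ Q = f ≫ R.coact := hf.colinear
  have h_cond : (A.coact ≫ f ▷ H) ≫ R.coact ▷ H =
      (A.coact ≫ f ▷ H) ≫ R.X ◁ leftCoact q ≫ (α_ R.X Q H).inv := by
    rw [Category.assoc, ← comp_whiskerRight, ← h_colinear, Category.assoc, Category.assoc,
      ← whisker_exchange_assoc, leftCoact, MonoidalCategory.whiskerLeft_comp_assoc,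
      reassoc_of% A.coact_comul]
    simp
  refine ⟨induceLift q _ h_cond, .of_comp_mono (isComodAlgHom_induceι q R) ?_, induceLift_ι q _ _⟩
  rw [induceLift_ι]
  refine ⟨inferInstance, ?_⟩
  change A.coact ≫ (A.coact ≫ f ▷ H) ▷ H = (A.coact ≫ f ▷ H) ≫ R.X ◁ Δ[H] ≫ (α_ R.X H H).inv
  rw [Category.assoc, ← whisker_exchange_assoc, reassoc_of% A.coact_comul]
  simp

variable (q R) in
/-- The counit `R □_Q H ⟶ R` of the adjunction between restriction and `- □_Q H`. -/
def induceCounit : (R.induce q).X ⟶ R.X :=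
  induceι q R.toRightComod ≫ R.X ◁ ε[H] ≫ (ρ_ R.X).hom

lemma isComodAlgHom_induceCounit :
    IsComodAlgHom ((R.induce q).restrict q) R (induceCounit q R) where
  isMonHom := by
    unfold induceCounit
    infer_instance
  colinear := by
    have h_ι : (R.induce q).coact ≫ induceι q R.toRightComod ▷ H =
        induceι q R.toRightComod ≫ R.X ◁ Δ[H] ≫ (α_ R.X H H).inv :=
      (isComodAlgHom_induceι q R).colinear
    trans induceι q R.toRightComod ≫ R.X ◁ q
    · rw [Category.assoc, whisker_exchange, induceCounit, comp_whiskerRight_assoc, reassoc_of% h_ι,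
        comp_whiskerRight_assoc, ← associator_inv_naturality_middle_assoc,
        ← MonoidalCategory.whiskerLeft_comp_assoc, ComonObj.counit_comul]
      simp
    · have h_counit := congrArg (R.X ◁ ·) (leftCoact_counit q)
      simp only [MonoidalCategory.whiskerLeft_comp] at h_counit
      rw [induceCounit, Category.assoc, Category.assoc, ← rightUnitor_naturality,
        whisker_exchange_assoc, reassoc_of% induceι_condition q R.toRightComod,
        ← associator_inv_naturality_right_assoc, reassoc_of% h_counit]
      simp

lemma comp_induceCounit {f : A.X ⟶ R.X} {F : A.X ⟶ (R.induce q).X}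
    (hF : F ≫ induceι q R.toRightComod = A.coact ≫ f ▷ H) : F ≫ induceCounit q R = f := by
  rw [induceCounit, reassoc_of% hF, ← whisker_exchange_assoc, reassoc_of% A.coact_counit]
  simp

end Adjunction

section InduceMap

variable {q} {R S : ComodAlg Q} {π : R.X ⟶ S.X} (hπ : IsComodAlgHom R S π)
include hπ

variable (q) in
/-- The morphism `R □_Q H ⟶ S □_Q H` induced by a morphism `R ⟶ S` of comodule algebras. -/
def induceMap : (R.induce q).X ⟶ (S.induce q).X :=
  cotensorMapLeft π hπ.colinear (LeftComod.ofHom q)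

lemma induceMap_ι : induceMap q hπ ≫ induceι q S.toRightComod =
    induceι q R.toRightComod ≫ π ▷ H :=
  cotensorMapLeft_ι _ _ _

lemma induceMap_counit : induceMap q hπ ≫ induceCounit q S = induceCounit q R ≫ π := by
  rw [induceCounit, induceCounit, reassoc_of% induceMap_ι hπ, ← whisker_exchange_assoc]
  simp

lemma isComodAlgHom_induceMap : IsComodAlgHom (R.induce q) (S.induce q) (induceMap q hπ) := by
  have := hπ.isMonHom
  refine .of_comp_mono (isComodAlgHom_induceι q S) ?_
  rw [induceMap_ι hπ]
  refine (isComodAlgHom_induceι q R).comp ⟨inferInstance, ?_⟩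
  change (R.X ◁ Δ[H] ≫ (α_ R.X H H).inv) ≫ π ▷ H ▷ H = π ▷ H ≫ S.X ◁ Δ[H] ≫ (α_ S.X H H).inv
  rw [Category.assoc, ← associator_inv_naturality_left, whisker_exchange_assoc]

lemma isNilpotentIdeal_kernel_induceMap (h : IsNilpotentIdeal (kernel.ι π)) :
    IsNilpotentIdeal (kernel.ι (induceMap q hπ)) := by
  obtain ⟨n, hn⟩ := h
  obtain ⟨l, hl⟩ := exists_comp_kernel_whiskerRight H π
    (kernel.ι (induceMap q hπ) ≫ induceι q R.toRightComod) (by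
      rw [Category.assoc, ← induceMap_ι hπ, kernel.condition_assoc, zero_comp])
  obtain ⟨s, hs⟩ := exists_comp_mulPow_eq l (kernel.ι π ▷ H) n
  obtain ⟨t, ht⟩ := exists_comp_mulPow_whiskerRight_eq (kernel.ι π) H n
  refine ⟨n, ?_⟩
  rw [← cancel_mono (induceι q R.toRightComod), mulPow_comp, ← hl, ← hs, ← ht, hn]
  simp

end InduceMap

end InducedAlgebra

section Coflat

open scoped HopfObj

variable [SymmetricCategory C] [Abelian C] [SplitEpiCategory C] [MonoidalPreadditive C]
  [HopfObj H] [IsCommMonObj H] [HopfObj Q] {q : H ⟶ Q} [IsBimonHom q] [IsCommMonObj Q]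
  (hq : IsCoflat (ComodAlg.ofHom q).toRightComod)
include hq

lemma epi_induceMap {R S : ComodAlg Q} {π : R.X ⟶ S.X} (hπ : IsComodAlgHom R S π) [Epi π] :
    Epi (induceMap q hπ) := by
  have : IsIso (X := (LeftComod.ofHom q).X) (Y := (ComodAlg.ofHom q).X) 𝒮[H] :=
    inferInstanceAs (IsIso 𝒮[H])
  refine hq.epi_cotensorMapLeft (W := LeftComod.ofHom q) 𝒮[H] ?_ π hπ.colinear
  change (Δ[H] ≫ q ▷ H) ≫ (β_ Q H).hom ≫ (𝒮[H] ⊗ₘ 𝒮[Q]) = 𝒮[H] ≫ Δ[H] ≫ H ◁ q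
  have h_comul := HopfObj.antipode_comul H
  rw [reassoc_of% h_comul, Category.assoc, BraidedCategory.braiding_naturality_left_assoc,
    ← id_tensorHom, tensorHom_comp_tensorHom, tensorHom_comp_tensorHom, HopfObj.hom_antipode q,
    Category.id_comp, Category.comp_id]

theorem ComodAlg.IsSmooth.restrict {A : ComodAlg H} (hA : A.IsSmooth) :
    (A.restrict q).IsSmooth := by
  intro R S π _ hπ hn f hf
  obtain ⟨F, hF, hF_ι⟩ := exists_isComodAlgHom_induce hf
  have := epi_induceMap hq hπ
  obtain ⟨G, hG, hG_map⟩ := hA _ _ (induceMap q hπ) (isComodAlgHom_induceMap hπ)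
    (isNilpotentIdeal_kernel_induceMap hπ hn) F hF
  refine ⟨G ≫ induceCounit q R, (hG.restrict q).comp isComodAlgHom_induceCounit, ?_⟩
  rw [Category.assoc, ← induceMap_counit hπ, reassoc_of% hG_map]
  exact comp_induceCounit hF_ι

theorem ofHom_isSmooth (h : (ComodAlg.regular H).IsSmooth) : (ComodAlg.ofHom q).IsSmooth :=
  h.restrict hq

end Coflat

end Induction

section Unit

variable {C : Type u} [Category.{v} C] [MonoidalCategory C] [SymmetricCategory C]

/-- The unit object as a Hopf algebra. -/
abbrev unitHopfObj (C : Type u) [Category.{v} C] [MonoidalCategory C] [SymmetricCategory C] :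
    HopfObj (𝟙_ C) where
  __ := ComonObj.instTensorUnit C
  mul_comul := by
    change (λ_ (𝟙_ C)).hom ≫ (λ_ (𝟙_ C)).inv = ((λ_ (𝟙_ C)).inv ⊗ₘ (λ_ (𝟙_ C)).inv) ≫
      tensorμ (𝟙_ C) (𝟙_ C) (𝟙_ C) (𝟙_ C) ≫ ((λ_ (𝟙_ C)).hom ⊗ₘ (λ_ (𝟙_ C)).hom)
    rw [tensorμ, braiding_tensorUnit_left]
    monoidal
  one_comul := by
    change 𝟙 _ ≫ (λ_ (𝟙_ C)).inv = (λ_ (𝟙_ C)).inv ≫ (𝟙 (𝟙_ C) ⊗ₘ 𝟙 (𝟙_ C))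
    simp
  mul_counit := by
    rw [Comon.tensorObj_counit]
    change (λ_ (𝟙_ C)).hom ≫ 𝟙 (𝟙_ C) = (𝟙 (𝟙_ C) ⊗ₘ 𝟙 (𝟙_ C)) ≫ _
    simp
  one_counit := by
    change 𝟙 _ ≫ 𝟙 (𝟙_ C) = 𝟙 _
    simp
  antipode := 𝟙 _
  antipode_left := by
    change (λ_ (𝟙_ C)).inv ≫ 𝟙 (𝟙_ C) ▷ 𝟙_ C ≫ (λ_ (𝟙_ C)).hom = 𝟙 _ ≫ 𝟙 (𝟙_ C)
    simp
  antipode_right := by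
    change (λ_ (𝟙_ C)).inv ≫ 𝟙_ C ◁ 𝟙 (𝟙_ C) ≫ (λ_ (𝟙_ C)).hom = 𝟙 _ ≫ 𝟙 (𝟙_ C)
    simp

attribute [local instance] unitHopfObj

lemma counit_unit : ε[𝟙_ C] = 𝟙 (𝟙_ C) := rfl

lemma comul_unit : Δ[𝟙_ C] = (λ_ (𝟙_ C)).inv := rfl

instance : IsCommMonObj (𝟙_ C) where
  mul_comm := by
    change (β_ (𝟙_ C) (𝟙_ C)).hom ≫ (λ_ (𝟙_ C)).hom = (λ_ (𝟙_ C)).hom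
    rw [braiding_tensorUnit_left]
    monoidal

instance (H : C) [BimonObj H] : IsBimonHom ε[H] where
  hom_counit := Category.comp_id _
  hom_comul := by
    change ε[H] ≫ (λ_ (𝟙_ C)).inv = Δ[H] ≫ (ε[H] ⊗ₘ ε[H])
    rw [MonoidalCategory.tensorHom_def, ComonObj.counit_comul_assoc]
    simp

lemma LeftComod.coact_unit (W : LeftComod (𝟙_ C)) : W.coact = (λ_ W.X).inv := by
  simpa [counit_unit] using W.coact_counit

lemma RightComod.coact_unit (V : RightComod (𝟙_ C)) : V.coact = (ρ_ V.X).inv := by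
  simpa [counit_unit] using V.coact_counit

/-- An algebra with the trivial coaction. -/
abbrev ComodAlg.trivial (R : C) [MonObj R] [IsCommMonObj R] : ComodAlg (𝟙_ C) where
  X := R
  coact := (ρ_ R).inv
  coact_counit := by rw [counit_unit]; simp
  coact_comul := by rw [comul_unit]; monoidal
  isMonHom_coact := inferInstance

lemma isComodAlgHom_unit {A B : ComodAlg (𝟙_ C)} {x : A.X ⟶ B.X} (hx : IsMonHom x) :
    IsComodAlgHom A B x where
  isMonHom := hx
  colinear := by
    rw [A.toRightComod.coact_unit, B.toRightComod.coact_unit, rightUnitor_inv_naturality]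

/-- Over the unit object, the cotensor product is the tensor product. -/
def cotensorIsoUnit [HasEqualizers C] (V : RightComod (𝟙_ C)) (W : LeftComod (𝟙_ C)) :
    cotensorObj V W ≅ V.X ⊗ W.X :=
  have : IsIso (cotensorι V W) :=
    equalizer.ι_of_eq (by rw [V.coact_unit, W.coact_unit]; monoidal)
  asIso (cotensorι V W)

variable [Abelian C] [SplitEpiCategory C] [MonoidalPreadditive C]

lemma isCoflat_unit (V : RightComod (𝟙_ C)) : IsCoflat V := by
  intro W₁ W₂ W₃ f g w hS
  have w' : (cotensor V).map f ≫ (cotensor V).map g = 0 := by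
    refine ((cotensor V).map_comp f g).symm.trans (cotensor_hom_ext ?_)
    refine (cotensorMap_ι V (f ≫ g)).trans (Eq.trans ?_ zero_comp.symm)
    change _ ≫ V.X ◁ (f.hom ≫ g.hom) = 0
    rw [w, MonoidalPreadditive.whiskerLeft_zero, comp_zero]
  refine ⟨w', ?_⟩
  have := hS.epi_g
  obtain ⟨s, h_section⟩ := exists_comp_eq_of_epi g.hom (𝟙 _)
  have h_tensor := ((ShortComplex.Splitting.ofExactOfSection _ hS.exact s h_section hS.mono_f).map
    (tensorLeft V.X)).shortExact
  refine ShortComplex.shortExact_of_iso (ShortComplex.isoMk (cotensorIsoUnit V W₁)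
    (cotensorIsoUnit V W₂) (cotensorIsoUnit V W₃) ?_ ?_).symm h_tensor
  · exact (cotensorMap_ι V f).symm
  · exact (cotensorMap_ι V g).symm

theorem isSmooth_of_ofHom_isSmooth (H : C) [HopfObj H] [IsCommMonObj H]
    (h : ∀ (Q : C) [HopfObj Q] [IsCommMonObj Q] (q : H ⟶ Q) [IsBimonHom q] [Epi q],
      IsCoflat (ComodAlg.ofHom q).toRightComod → (ComodAlg.ofHom q).IsSmooth) : IsSmooth H := by
  intro R S _ _ _ _ π hπ _ hn f hf
  have : Epi ε[H] := epi_of_epi_fac (BimonObj.one_counit H)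
  obtain ⟨g, hg, h_comp⟩ := h (𝟙_ C) ε[H] (isCoflat_unit _) (.trivial R) (.trivial S) π
    (isComodAlgHom_unit hπ) hn f (isComodAlgHom_unit (A := .ofHom ε[H]) hf)
  exact ⟨g, hg.isMonHom, h_comp⟩

end Unit

end HopfSmooth

end

theorem theorem1p2_general {C : Type u} [Category.{v} C] [Abelian C] [SplitEpiCategory C]
    [MonoidalCategory C] [SymmetricCategory C] [MonoidalPreadditive C]
    (H : C) [HopfObj H] [IsCommMonObj H] :
    List.TFAE [
      HopfSmooth.IsSmooth H,
      (HopfSmooth.ComodAlg.regular H).IsSmooth,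
      ∀ (Q : C) [HopfObj Q] [IsCommMonObj Q] (q : H ⟶ Q) [IsBimonHom q] [Epi q],
        HopfSmooth.IsCoflat (HopfSmooth.ComodAlg.ofHom q).toRightComod →
          (HopfSmooth.ComodAlg.ofHom q).IsSmooth,
      Mono (HopfSmooth.muHom H)] := by
  tfae_have 1 → 4 := HopfSmooth.mono_muHom_of_isSmooth H
  tfae_have 4 → 2 := fun _ => HopfSmooth.regular_isSmooth_of_mono_muHom H
  tfae_have 2 → 3 := fun h Q _ _ q _ _ hq => HopfSmooth.ofHom_isSmooth hq h
  tfae_have 3 → 1 := HopfSmooth.isSmooth_of_ofHom_isSmooth H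
  tfae_finish

theorem theorem1p2 {C : Type u} [Category.{v} C] [Abelian C] [MonoidalCategory C]
    [SymmetricCategory C] [MonoidalPreadditive C] (hC : IsSemisimpleCategory C)
    (H : C) [HopfObj H] [IsCommMonObj H] :
    List.TFAE [
      HopfSmooth.IsSmooth H,
      (HopfSmooth.ComodAlg.regular H).IsSmooth,
      ∀ (Q : C) [HopfObj Q] [IsCommMonObj Q] (q : H ⟶ Q) [IsBimonHom q] [Epi q],
        HopfSmooth.IsCoflat (HopfSmooth.ComodAlg.ofHom q).toRightComod →
          (HopfSmooth.ComodAlg.ofHom q).IsSmooth,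
      Mono (HopfSmooth.muHom H)] := by
  have := HopfSmooth.splitEpiCategory_of_isSemisimpleCategory hC
  exact theorem1p2_general H
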